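/- Let $l$ be an integer with $3\le l\le 10$ or $l=12$, let $n$ and $c$ be independent indeterminates (for $l=3$, $c$ denotes a pair of indeterminates $(a_1,a_3)$), and let $E_{c,l}$ be Kubert's family of curves with the point $A=(0,0)$, given by an equation with coefficients in $\mathbf Z[c]$ as follows. For $l=3$ it is $y^2+a_1xy+a_3y=x^3$. For $l\ge 4$ it is $$y^2+u(1-s)xy-u^3b\,y=x^3-u^2b\,x^2,$$ i.e. the Tate normal form $y^2+(1-s)xy-by=x^3-bx^2$ after the substitution $(x,y)\mapsto(u^2x,u^3y)$, where $u=1$ except for $l=8,10,12$, and - $l=4$: $s=0$, $b=-c$; - $l=5$: $s=b=c$; - $l=6$: $s=c$, $b=c+c^2$; - $l=7$: $s=c^2-c$, $b=c^3-c^2$; - $l=8$: $u=c$, $s=(2c-1)(c-1)/c$, $b=(2c-1)(c-1)$; - $l=9$: $s=c^2(c-1)$, $b=s(c(c-1)+1)$; - $l=10$: $u=c-(c-1)^2$, $s=(2c^3-3c^2+c)/u$, $b=sc^2/u$; - $l=12$: $u=(c-1)^3$, $s=(3c^2-3c+1)(c-2c^2)/(c-1)^3$, $b=s(2c-2c^2-1)/(c-1)$.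 Then $E_{c,l}$ is an elliptic curve and $A$ is a point of order $l$ on it. Let $K=\mathbf Q(n,c)$ and let $\overline K$ be an algebraic closure of $K$. There exist points $P\in E_{c,l}(\overline K)\setminus\langle A\rangle$ such that $\sum_{i=0}^{l-1}x(P+iA)=n$, where $x(\cdot)$ is the abscissa, and there is a polynomial $P_{n,c,l}\in\mathbf Z[n,c][x]$ such that for every such point $P$ $$P_{n,c,l}(x)=\prod_{i=0}^{l-1}\bigl(x-x(P+iA)\bigr)=x^l-nx^{l-1}+\cdots .$$ This polynomial is irreducible over $\mathbf Q(n,c)$, and the Galois group over $\mathbf Q(n,c)$ of its splitting field is isomorphic to the dihedral group $D_l$ of order $2l$. -/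

import Mathlib

open Polynomial

/-- The number of curve parameters minus one: `c` stands for a pair of parameters when `l = 3`
and for a single parameter otherwise. -/
def extraParams (l : ℕ) : ℕ := if l = 3 then 1 else 0

/-- The ring `ℤ[c]` (`ℤ[a₁, a₃]` when `l = 3`). -/
abbrev BaseRing (l : ℕ) : Type := MvPolynomial (Fin (extraParams l + 1)) ℤ

/-- The ring `ℤ[n, c]`, as polynomials in `n` over `ℤ[c]`. -/
abbrev ParamRing (l : ℕ) : Type := (BaseRing l)[X]

/-- The field `ℚ(n, c)`. -/
abbrev ParamField (l : ℕ) : Type := FractionRing (ParamRing l)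

/-- The Tate normal form `y² + (1 - s) x y - b y = x³ - b x²`, with `s = S / u` and `b = B / u²`,
written after the change of variables `(x, y) ↦ (u² x, u³ y)` that clears denominators:
`y² + (u - S) x y - u B y = x³ - B x²`. -/
def tateCurve {R : Type*} [CommRing R] (u S B : R) : WeierstrassCurve R where
  a₁ := u - S
  a₂ := -B
  a₃ := -(u * B)
  a₄ := 0
  a₆ := 0

/-- Kubert's family of elliptic curves with the point `(0, 0)` of order `l`, for `3 ≤ l ≤ 10` or
`l = 12`. For `l = 3` the two parameters are `c = a₁` and `a = a₃`; the parameter `a` is not used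
for the other values of `l`. In Tate normal form, the values of `(s, b)` are:
* `l = 4`: `s = 0`, `b = -c`;
* `l = 5`: `s = c`, `b = c`;
* `l = 6`: `s = c`, `b = c + c²`;
* `l = 7`: `s = c² - c`, `b = c³ - c²`;
* `l = 8`: `s = (2c - 1)(c - 1) / c`, `b = (2c - 1)(c - 1)`;
* `l = 9`: `s = c²(c - 1)`, `b = s (c(c - 1) + 1)`;
* `l = 10`: `s = (2c³ - 3c² + c) / (c - (c - 1)²)`, `b = s c² / (c - (c - 1)²)`;
* `l = 12`: `s = (3c² - 3c + 1)(c - 2c²) / (c - 1)³`, `b = s (2c - 2c² - 1) / (c - 1)`.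

For `l = 8, 10, 12` the denominators are cleared with `u = c`, `u = c - (c - 1)²` and
`u = (c - 1)³` respectively. The value for all other `l` is irrelevant. -/
def kubertFamily {R : Type*} [CommRing R] (l : ℕ) (c a : R) : WeierstrassCurve R :=
  match l with
  | 3 => { a₁ := c, a₂ := 0, a₃ := a, a₄ := 0, a₆ := 0 }
  | 4 => tateCurve 1 0 (-c)
  | 5 => tateCurve 1 c c
  | 6 => tateCurve 1 c (c + c ^ 2)
  | 7 => tateCurve 1 (c ^ 2 - c) (c ^ 3 - c ^ 2)
  | 8 => tateCurve c ((2 * c - 1) * (c - 1)) (c ^ 2 * ((2 * c - 1) * (c - 1)))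
  | 9 => tateCurve 1 (c ^ 2 * (c - 1)) (c ^ 2 * (c - 1) * (c * (c - 1) + 1))
  | 10 => tateCurve (c - (c - 1) ^ 2) (2 * c ^ 3 - 3 * c ^ 2 + c)
      ((2 * c ^ 3 - 3 * c ^ 2 + c) * c ^ 2)
  | 12 => tateCurve ((c - 1) ^ 3) ((3 * c ^ 2 - 3 * c + 1) * (c - 2 * c ^ 2))
      ((3 * c ^ 2 - 3 * c + 1) * (c - 2 * c ^ 2) * (2 * c - 2 * c ^ 2 - 1) * (c - 1) ^ 2)
  | _ => { a₁ := 0, a₂ := 0, a₃ := 0, a₄ := 0, a₆ := 0 }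

/-- The curve `E_{c,l}` with indeterminate parameter(s) `c`, over `ℤ[c]`. -/
noncomputable def kubertCurve (l : ℕ) : WeierstrassCurve (BaseRing l) :=
  kubertFamily l (MvPolynomial.X 0) (MvPolynomial.X (Fin.last _))

/-- The embedding of `ℤ[n, c]` in its fraction field `ℚ(n, c)`. -/
noncomputable abbrev toField (l : ℕ) : ParamRing l →+* ParamField l :=
  algebraMap (ParamRing l) (ParamField l)

/-- The embedding of `ℤ[n, c]` in an algebraic closure of `ℚ(n, c)`. -/
noncomputable abbrev toClosure (l : ℕ) : ParamRing l →+* AlgebraicClosure (ParamField l) :=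
  (algebraMap (ParamField l) (AlgebraicClosure (ParamField l))).comp (toField l)

/-- The curve `E_{c,l}` over an algebraic closure of `ℚ(n, c)`. -/
noncomputable abbrev geomCurve (l : ℕ) :
    WeierstrassCurve.Affine (AlgebraicClosure (ParamField l)) :=
  ((kubertCurve l).map ((toClosure l).comp C)).toAffine

/-- The indeterminate `n`, in an algebraic closure of `ℚ(n, c)`. -/
noncomputable def nParam (l : ℕ) : AlgebraicClosure (ParamField l) :=
  toClosure l X

/-- The abscissa of an affine point (with value `0` at the point at infinity). -/
def xCoord {F : Type*} [Field F] {W : WeierstrassCurve.Affine F} : W.Point → F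
  | .zero => 0
  | .some x _ _ => x

open scoped Classical in
/-- The sum of the abscissas of `P, P + A, …, P + (l - 1) A`. -/
noncomputable def translateSum {F : Type*} [Field F] {W : WeierstrassCurve.Affine F}
    (A P : W.Point) (l : ℕ) : F :=
  ∑ i ∈ Finset.range l, xCoord (P + i • A)

open scoped Classical in
/-- The polynomial `∏_{i=0}^{l-1} (x - x(P + iA))`. -/
noncomputable def translatePoly {F : Type*} [Field F] {W : WeierstrassCurve.Affine F}
    (A P : W.Point) (l : ℕ) : F[X] :=
  ∏ i ∈ Finset.range l, (X - C (xCoord (P + i • A)))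

/-!
The sum `∑ x(P + iA)` is invariant under translation by `A` and under `P ↦ -P`, so it is a rational
function of `x(P)`. Pairing `i` with `l - i` and using the formula for `x(P + Q) + x(P - Q)` writes
it as `f(x) / g(x)`, with `f` and `g` monic of degrees `l` and `l - 1`; their coefficients lie in
`R = ℤ[c]` because all multiples of `A` have coordinates in `R`. The required polynomial is
`f - n g` (`fiberPoly`).

* It is irreducible by Gauss's lemma: it has degree one in `n`, and `f` and `g` have no common zero
  (`IsIntegralCycle.irreducible_fiberPoly`).
* A root `x` of it is not a zero of `g`, so it is the abscissa of a point `P` outside `⟨A⟩` with sum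
  `n`. As `n` is transcendental over `R`, so is `x(P)`; hence `2 P` is not a multiple of `A`, the
  abscissas `x(P + iA)` are distinct, and they are all the roots
  (`IsIntegralCycle.map_fiberPoly_eq_translatePoly`).
* An automorphism `σ` over `K = ℚ(n, c)` maps `P` to some `±P + jA`, which gives a homomorphism from
  the Galois group to the dihedral group. Its kernel is the subgroup fixing the roots. It is
  surjective: irreducibility makes the group transitive on the roots, and some `σ` maps `P` to `-P`
  since `(2 y + a₁ x + a₃)²` is a cubic polynomial in `x`, which is not a square in
  `K(x(P)) = ℚ(c)(x(P))` (`IsIntegralCycle.nonempty_gal_mulEquiv`).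

What is particular to Kubert's curves is that `A` has order `l` and that its multiples are integral;
this is verified by computing the multiples `i • A` for `i ≤ l / 2`, or `i ≤ l / 2 + 1` if `l ≥ 5`
is odd.
-/

/-! ### Abscissas of points -/

section Abscissas

open scoped Classical

open WeierstrassCurve.Affine (Point)

variable {F : Type*} [Field F] {W : WeierstrassCurve.Affine F}

lemma xCoord_neg (P : W.Point) : xCoord (-P) = xCoord P := by
  rcases P with _ | ⟨x, y, h⟩ <;> rfl

lemma eq_or_eq_neg_of_xCoord_eq {P Q : W.Point} (hP : P ≠ 0) (hQ : Q ≠ 0)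
    (h : xCoord P = xCoord Q) : P = Q ∨ P = -Q := by
  rcases P with _ | ⟨x, y, hxy⟩
  · exact absurd rfl hP
  rcases Q with _ | ⟨x', y', hxy'⟩
  · exact absurd rfl hQ
  exact Point.X_eq_iff.mp h

lemma some_add_some_of_slope {x y a b m : F} (h : W.Nonsingular x y) (h' : W.Nonsingular a b)
    (hxa : x ≠ a) (hm : y - b = m * (x - a)) :
    ∃ h'', Point.some x y h + Point.some a b h' =
      Point.some (m ^ 2 + W.a₁ * m - W.a₂ - x - a)
        (-(m * (m ^ 2 + W.a₁ * m - W.a₂ - x - a - x) + y)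
          - W.a₁ * (m ^ 2 + W.a₁ * m - W.a₂ - x - a) - W.a₃) h'' := by
  have hs : W.slope x a y b = m := by
    rw [WeierstrassCurve.Affine.slope_of_X_ne hxa, hm,
      mul_div_cancel_right₀ _ (sub_ne_zero.mpr hxa)]
  have key := Point.add_of_X_ne (h₁ := h) (h₂ := h') hxa
  simp only [hs, WeierstrassCurve.Affine.addX, WeierstrassCurve.Affine.addY,
    WeierstrassCurve.Affine.negAddY, WeierstrassCurve.Affine.negY] at key
  exact ⟨_, key⟩

/-- The sum of `x(P + Q)` and `x(P - Q)` is a rational function of `x(P)`. -/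
lemma xCoord_add_add_xCoord_sub {x y a b : F} (h : W.Nonsingular x y) (h' : W.Nonsingular a b)
    (hxa : x ≠ a) :
    (xCoord (Point.some x y h + Point.some a b h') +
      xCoord (Point.some x y h - Point.some a b h')) * (x - a) ^ 2 =
      2 * a * (x - a) ^ 2 + (6 * a ^ 2 + W.b₂ * a + W.b₄) * (x - a) +
        (4 * a ^ 3 + W.b₂ * a ^ 2 + 2 * W.b₄ * a + W.b₆) := by
  have hd : x - a ≠ 0 := sub_ne_zero.mpr hxa
  have e := (W.equation_iff x y).mp h.1
  have e' := (W.equation_iff a b).mp h'.1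
  rw [sub_eq_add_neg (Point.some x y h), Point.neg_some]
  obtain ⟨k, hk⟩ := some_add_some_of_slope h h' hxa (m := (y - b) / (x - a)) (by field_simp)
  obtain ⟨k', hk'⟩ := some_add_some_of_slope h ((W.nonsingular_neg ..).mpr h') hxa
    (m := (y - W.negY a b) / (x - a)) (by field_simp)
  rw [hk, hk']
  simp only [xCoord, WeierstrassCurve.Affine.negY, WeierstrassCurve.b₂, WeierstrassCurve.b₄,
    WeierstrassCurve.b₆]
  field_simp
  linear_combination 2 * e + 2 * e'

/-- Translation by a point `Q` of order two, on abscissas. -/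
lemma xCoord_add_of_two_torsion {x y a b : F} (h : W.Nonsingular x y) (h' : W.Nonsingular a b)
    (hxa : x ≠ a) (hb : 2 * b + W.a₁ * a + W.a₃ = 0) :
    xCoord (Point.some x y h + Point.some a b h') * (x - a) =
      a * (x - a) + (3 * a ^ 2 + 2 * W.a₂ * a + W.a₄ - W.a₁ * b) := by
  have hd : x - a ≠ 0 := sub_ne_zero.mpr hxa
  have e := (W.equation_iff x y).mp h.1
  have e' := (W.equation_iff a b).mp h'.1
  obtain ⟨k, hk⟩ := some_add_some_of_slope h h' hxa (m := (y - b) / (x - a)) (by field_simp)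
  rw [hk]
  simp only [xCoord]
  refine mul_right_cancel₀ hd ?_
  field_simp
  linear_combination e - e' + (b - y) * hb

lemma two_y_add_eq_zero_iff {a b : F} (h : W.Nonsingular a b) :
    2 * b + W.a₁ * a + W.a₃ = 0 ↔ (2 : ℕ) • Point.some a b h = 0 := by
  rw [two_nsmul, ← eq_neg_iff_add_eq_zero (a := Point.some a b h), Point.neg_some, Point.some.injEq]
  simp only [WeierstrassCurve.Affine.negY, true_and]
  constructor <;> intro h <;> linear_combination h

/-- The square of `2 y + a₁ x + a₃`, as a polynomial in `x`. -/
lemma two_y_add_sq {x y : F} (h : W.Equation x y) :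
    (2 * y + W.a₁ * x + W.a₃) ^ 2 = 4 * x ^ 3 + W.b₂ * x ^ 2 + 2 * W.b₄ * x + W.b₆ := by
  have e := (W.equation_iff x y).mp h
  simp only [WeierstrassCurve.b₂, WeierstrassCurve.b₄, WeierstrassCurve.b₆]
  linear_combination 4 * e

/-- The duplication formula on abscissas. -/
lemma xCoord_two_nsmul {x y : F} (h : W.Nonsingular x y)
    (h2 : (2 : ℕ) • Point.some x y h ≠ 0) :
    xCoord ((2 : ℕ) • Point.some x y h) * (4 * x ^ 3 + W.b₂ * x ^ 2 + 2 * W.b₄ * x + W.b₆) =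
      x ^ 4 - W.b₄ * x ^ 2 - 2 * W.b₆ * x - W.b₈ := by
  have hy : 2 * y + W.a₁ * x + W.a₃ ≠ 0 := fun h0 ↦ h2 ((two_y_add_eq_zero_iff h).mp h0)
  have hy' : y ≠ W.negY x y := by
    intro h0
    rw [WeierstrassCurve.Affine.negY] at h0
    exact hy (by linear_combination h0)
  have e := (W.equation_iff x y).mp h.1
  rw [← two_y_add_sq h.1, two_nsmul, Point.add_self_of_Y_ne hy']
  have hs : y - W.negY x y = 2 * y + W.a₁ * x + W.a₃ := by
    rw [WeierstrassCurve.Affine.negY]; ring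
  simp only [xCoord, WeierstrassCurve.Affine.addX,
    WeierstrassCurve.Affine.slope_of_Y_ne rfl hy', hs, WeierstrassCurve.b₄,
    WeierstrassCurve.b₆, WeierstrassCurve.b₈]
  have key (N d r : F) (hd : d ≠ 0) :
      ((N / d) ^ 2 + W.a₁ * (N / d) - r) * d ^ 2 = N ^ 2 + W.a₁ * N * d - r * d ^ 2 := by
    field_simp
  simp only [sub_sub]
  rw [key _ _ _ hy]
  linear_combination (-W.a₁ ^ 2 - 4 * W.a₂ - 8 * x) * e

end Abscissas

/-! ### The sum of the abscissas of the translates as a rational function -/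

section TranslateSum

open scoped Classical

open Finset
open WeierstrassCurve.Affine (Point)

/-- Pairing the indices `i` and `l - i` in a sum over `0 ≤ i < l`. -/
lemma sum_range_eq_sum_Icc_half {M : Type*} [AddCommMonoid M] (h : ℕ → M) {l : ℕ} (hl : 1 ≤ l) :
    ∑ i ∈ range l, h i =
      h 0 + ∑ i ∈ Icc 1 (l / 2), if 2 * i = l then h i else h i + h (l - i) := by
  have hsplit : range l = insert 0 (Icc 1 (l / 2) ∪ Ioo (l / 2) l) := by
    ext i
    simp only [mem_range, mem_insert, mem_union, mem_Icc, mem_Ioo]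
    omega
  have hdisj : Disjoint (Icc 1 (l / 2)) (Ioo (l / 2) l) := by
    rw [Finset.disjoint_left]
    intro i
    simp only [mem_Icc, mem_Ioo]
    omega
  have hrefl : ∑ i ∈ Ioo (l / 2) l, h i =
      ∑ i ∈ Icc 1 (l / 2) with ¬ 2 * i = l, h (l - i) := by
    refine sum_nbij' (fun i ↦ l - i) (fun i ↦ l - i) ?_ ?_ ?_ ?_ ?_ <;> intro i <;>
      simp only [mem_Icc, mem_Ioo, mem_filter] <;> intro hi
    · omega
    · omega
    · omega
    · omega
    · congr 1
      omega
  rw [hsplit, sum_insert (by simp), sum_union hdisj, hrefl, sum_filter, ← sum_add_distrib]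
  congr 1
  refine sum_congr rfl fun i _ ↦ ?_
  split_ifs <;> simp_all

/-- The points `i • A`, for `1 ≤ i ≤ l / 2`, on the base change to `F` of a curve over `R`, have
coordinates `(a i, b i)` in `R`, and `A` has order `l`. The multiples `i • A` for other `i` are
determined by these, as `(l - i) • A = -(i • A)`. -/
structure IsIntegralCycle {R F : Type*} [CommRing R] [Field F] [Algebra R F]
    (W : WeierstrassCurve R) (A : (W.baseChange F).toAffine.Point) (l : ℕ) (a b : ℕ → R) :
    Prop where
  three_le : 3 ≤ l
  addOrderOf_eq : addOrderOf A = l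
  nsmul_eq : ∀ i ∈ Icc 1 (l / 2), ∃ h, i • A =
    Point.some (algebraMap R F (a i)) (algebraMap R F (b i)) h

variable {R : Type*} [CommRing R]

/-- The denominator of `x(P + iA) + x(P - iA)`, or of `x(P + iA)` if `iA = -iA`, as a polynomial in
`x(P)`. -/
noncomputable def pairDen (l : ℕ) (a : ℕ → R) (i : ℕ) : R[X] :=
  if 2 * i = l then X - C (a i) else (X - C (a i)) ^ 2

/-- The numerator of `x(P + iA) + x(P - iA)`, or of `x(P + iA)` if `iA = -iA`, as a polynomial in
`x(P)`. -/
noncomputable def pairNum (W : WeierstrassCurve R) (l : ℕ) (a b : ℕ → R) (i : ℕ) : R[X] :=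
  if 2 * i = l then
    C (a i) * (X - C (a i)) + C (3 * a i ^ 2 + 2 * W.a₂ * a i + W.a₄ - W.a₁ * b i)
  else C (2 * a i) * (X - C (a i)) ^ 2 + C (6 * a i ^ 2 + W.b₂ * a i + W.b₄) * (X - C (a i)) +
    C (4 * a i ^ 3 + W.b₂ * a i ^ 2 + 2 * W.b₄ * a i + W.b₆)

/-- The denominator of `∑ x(P + iA)` as a polynomial in `x(P)`. -/
noncomputable def translateDen (l : ℕ) (a : ℕ → R) : R[X] :=
  ∏ i ∈ Icc 1 (l / 2), pairDen l a i

/-- The numerator of `∑ x(P + iA) - x(P)` as a polynomial in `x(P)`. -/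
noncomputable def translateRem (W : WeierstrassCurve R) (l : ℕ) (a b : ℕ → R) : R[X] :=
  ∑ i ∈ Icc 1 (l / 2), pairNum W l a b i * ∏ j ∈ (Icc 1 (l / 2)).erase i, pairDen l a j

/-- The numerator of `∑ x(P + iA)` as a polynomial in `x(P)`. -/
noncomputable def translateNum (W : WeierstrassCurve R) (l : ℕ) (a b : ℕ → R) : R[X] :=
  X * translateDen l a + translateRem W l a b

/-- The polynomial in `x(P)`, with coefficients in `R[n]`, expressing that `∑ x(P + iA) = n`; the
indeterminate `n` is the inner variable `C X` of `R[X][X]`. -/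
noncomputable def fiberPoly (W : WeierstrassCurve R) (l : ℕ) (a b : ℕ → R) : R[X][X] :=
  (translateNum W l a b).map C - C X * (translateDen l a).map C

section Degree

variable (W : WeierstrassCurve R) (l : ℕ) (a b : ℕ → R)

lemma monic_pairDen (i : ℕ) : (pairDen l a i).Monic := by
  unfold pairDen
  split_ifs
  · exact monic_X_sub_C _
  · exact (monic_X_sub_C _).pow 2

lemma natDegree_pairDen [Nontrivial R] (i : ℕ) :
    (pairDen l a i).natDegree = if 2 * i = l then 1 else 2 := by
  unfold pairDen
  split_ifs
  · exact natDegree_X_sub_C _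
  · rw [(monic_X_sub_C _).natDegree_pow, natDegree_X_sub_C]

lemma natDegree_pairNum_le [Nontrivial R] (i : ℕ) :
    (pairNum W l a b i).natDegree ≤ (pairDen l a i).natDegree := by
  rw [natDegree_pairDen]
  unfold pairNum
  split_ifs <;> compute_degree

lemma monic_translateDen : (translateDen l a).Monic :=
  monic_prod_of_monic _ _ fun i _ ↦ monic_pairDen l a i

lemma natDegree_translateDen [Nontrivial R] (hl : 1 ≤ l) :
    (translateDen l a).natDegree + 1 = l := by
  have h := sum_range_eq_sum_Icc_half (fun _ ↦ 1) hl
  rw [translateDen, natDegree_prod_of_monic _ _ fun i _ ↦ monic_pairDen l a i]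
  simp only [sum_const, card_range, smul_eq_mul, mul_one, one_add_one_eq_two] at h
  rw [sum_congr rfl fun i _ ↦ natDegree_pairDen l a i]
  omega

lemma natDegree_translateRem_le [Nontrivial R] :
    (translateRem W l a b).natDegree ≤ (translateDen l a).natDegree := by
  refine natDegree_sum_le_of_forall_le _ _ fun i hi ↦ natDegree_mul_le.trans ?_
  rw [translateDen, ← mul_prod_erase _ _ hi, (monic_pairDen l a i).natDegree_mul
    (monic_prod_of_monic _ _ fun j _ ↦ monic_pairDen l a j)]
  exact Nat.add_le_add_right (natDegree_pairNum_le W l a b i) _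

lemma fiberPoly_eq : fiberPoly W l a b = X * (translateDen l a).map C +
    ((translateRem W l a b).map C - C X * (translateDen l a).map C) := by
  rw [fiberPoly, translateNum, Polynomial.map_add, Polynomial.map_mul, map_X]
  ring

lemma natDegree_fiberPoly_rem_lt [Nontrivial R] :
    ((translateRem W l a b).map C - C X * (translateDen l a).map C : R[X][X]).natDegree <
      (X * (translateDen l a).map C : R[X][X]).natDegree := by
  rw [monic_X.natDegree_mul ((monic_translateDen l a).map C), natDegree_X,
    (monic_translateDen l a).natDegree_map, add_comm, Nat.lt_succ_iff]
  refine (natDegree_sub_le _ _).trans (max_le ?_ ?_)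
  · exact natDegree_map_le.trans (natDegree_translateRem_le W l a b)
  · exact (natDegree_C_mul_le _ _).trans natDegree_map_le

lemma monic_fiberPoly [Nontrivial R] : (fiberPoly W l a b).Monic := by
  rw [fiberPoly_eq]
  exact (monic_X.mul ((monic_translateDen l a).map C)).add_of_left
    (degree_lt_degree (natDegree_fiberPoly_rem_lt W l a b))

lemma natDegree_fiberPoly [Nontrivial R] (hl : 1 ≤ l) : (fiberPoly W l a b).natDegree = l := by
  rw [fiberPoly_eq, natDegree_add_eq_left_of_natDegree_lt (natDegree_fiberPoly_rem_lt W l a b),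
    monic_X.natDegree_mul ((monic_translateDen l a).map C), natDegree_X,
    (monic_translateDen l a).natDegree_map, add_comm, natDegree_translateDen l a hl]

end Degree

namespace IsIntegralCycle

variable {F : Type*} [Field F] [Algebra R F] {W : WeierstrassCurve R}
  {A : (W.baseChange F).toAffine.Point} {l : ℕ} {a b : ℕ → R}

lemma sub_nsmul (H : IsIntegralCycle W A l a b) {i : ℕ} (hi : i ≤ l) :
    (l - i) • A = -(i • A) := by
  rw [eq_neg_iff_add_eq_zero, ← add_nsmul, Nat.sub_add_cancel hi, ← H.addOrderOf_eq,
    addOrderOf_nsmul_eq_zero]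

/-- A point outside `⟨A⟩` is affine and has an abscissa other than those of the multiples of `A`. -/
lemma exists_eq_some (H : IsIntegralCycle W A l a b) {P : (W.baseChange F).toAffine.Point}
    (hP : P ∉ AddSubgroup.zmultiples A) :
    ∃ x y h, P = Point.some x y h ∧ ∀ i ∈ Icc 1 (l / 2), x ≠ algebraMap R F (a i) := by
  rcases P with _ | ⟨x, y, h⟩
  · exact absurd (zero_mem _) hP
  refine ⟨x, y, h, rfl, fun i hi hx ↦ hP ?_⟩
  obtain ⟨h', hA⟩ := H.nsmul_eq i hi
  rcases Point.X_eq_iff (h₁ := h) (h₂ := h') |>.mp hx with h0 | h0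
  · rw [h0, ← hA]
    exact nsmul_mem (AddSubgroup.mem_zmultiples A) i
  · rw [h0, ← hA]
    exact neg_mem (nsmul_mem (AddSubgroup.mem_zmultiples A) i)

lemma two_nsmul_eq_zero_iff (H : IsIntegralCycle W A l a b) {i : ℕ} (hi : i ∈ Icc 1 (l / 2)) :
    (2 : ℕ) • i • A = 0 ↔ 2 * i = l := by
  rw [mem_Icc] at hi
  rw [← mul_nsmul', ← addOrderOf_dvd_iff_nsmul_eq_zero, H.addOrderOf_eq]
  constructor
  · intro h
    exact le_antisymm (by omega) (Nat.le_of_dvd (by omega) h)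
  · rintro h
    rw [h]

/-- The sum of the abscissas of the translates is `translateNum / translateDen`. -/
lemma translateSum_mul (H : IsIntegralCycle W A l a b) {x y : F}
    {h : (W.baseChange F).toAffine.Nonsingular x y}
    (hx : ∀ i ∈ Icc 1 (l / 2), x ≠ algebraMap R F (a i)) :
    translateSum A (Point.some x y h) l * aeval x (translateDen l a) =
      aeval x (translateNum W l a b) := by
  have hterm (i : ℕ) (hi : i ∈ Icc 1 (l / 2)) :
      (if 2 * i = l then xCoord (Point.some x y h + i • A)
        else xCoord (Point.some x y h + i • A) + xCoord (Point.some x y h + (l - i) • A)) *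
      aeval x (pairDen l a i) = aeval x (pairNum W l a b i) := by
    obtain ⟨h', hA⟩ := H.nsmul_eq i hi
    have h2 := H.two_nsmul_eq_zero_iff hi
    rw [H.sub_nsmul (by rw [mem_Icc] at hi; omega), ← sub_eq_add_neg]
    rw [hA] at h2 ⊢
    unfold pairDen pairNum
    split_ifs with hil
    · have := xCoord_add_of_two_torsion h h' (hx i hi)
        ((two_y_add_eq_zero_iff h').mpr (h2.mpr hil))
      simpa [WeierstrassCurve.baseChange, map_ofNat (algebraMap R F)] using this
    · have := xCoord_add_add_xCoord_sub h h' (hx i hi)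
      simpa [WeierstrassCurve.baseChange, map_ofNat (algebraMap R F)] using this
  rw [translateSum, sum_range_eq_sum_Icc_half _ (by linarith [H.three_le]), zero_nsmul, add_zero,
    translateNum, map_add, map_mul, aeval_X, add_mul, translateRem, map_sum, sum_mul]
  congr 1
  refine sum_congr rfl fun i hi ↦ ?_
  rw [translateDen, ← mul_prod_erase _ _ hi, map_mul, ← mul_assoc, hterm i hi, map_mul]

lemma aeval_translateDen_ne_zero {x : F} (hx : ∀ i ∈ Icc 1 (l / 2), x ≠ algebraMap R F (a i)) :
    aeval x (translateDen l a) ≠ 0 := by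
  rw [translateDen, map_prod, prod_ne_zero_iff]
  intro i hi
  have := sub_ne_zero.mpr (hx i hi)
  unfold pairDen
  split_ifs <;> simpa using this

lemma a_injOn [FaithfulSMul R F] (H : IsIntegralCycle W A l a b) {i j : ℕ}
    (hi : i ∈ Icc 1 (l / 2)) (hj : j ∈ Icc 1 (l / 2)) (h : a i = a j) : i = j := by
  obtain ⟨hi', hAi⟩ := H.nsmul_eq i hi
  obtain ⟨hj', hAj⟩ := H.nsmul_eq j hj
  rw [mem_Icc] at hi hj
  have h3 := H.three_le
  rcases Point.X_eq_iff (h₁ := hi') (h₂ := hj') |>.mp (by rw [h]) with h0 | h0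
  · rw [← hAi, ← hAj] at h0
    have := (nsmul_inj_mod (x := A)).mp h0
    rwa [H.addOrderOf_eq, Nat.mod_eq_of_lt (by omega), Nat.mod_eq_of_lt (by omega)] at this
  · rw [← hAi, ← hAj, eq_neg_iff_add_eq_zero, ← add_nsmul,
      ← addOrderOf_dvd_iff_nsmul_eq_zero, H.addOrderOf_eq] at h0
    have := Nat.le_of_dvd (by omega) h0
    omega

lemma eval_pairNum_ne_zero [FaithfulSMul R F] (H : IsIntegralCycle W A l a b) {i : ℕ}
    (hi : i ∈ Icc 1 (l / 2)) : (pairNum W l a b i).eval (a i) ≠ 0 := by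
  obtain ⟨h', hA⟩ := H.nsmul_eq i hi
  have h2 := H.two_nsmul_eq_zero_iff hi
  rw [hA, ← two_y_add_eq_zero_iff h'] at h2
  intro h0
  have h1 : algebraMap R F ((pairNum W l a b i).eval (a i)) = 0 := by rw [h0, map_zero]
  unfold pairNum at h1
  split_ifs at h1 with hil
  · have hb := h2.mpr hil
    have hn := ((WeierstrassCurve.Affine.nonsingular_iff _ _).mp h').2
    simp [map_ofNat (algebraMap R F)] at h1
    simp [WeierstrassCurve.baseChange] at hn hb
    rcases hn with hn | hn
    · exact hn (by linear_combination -h1)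
    · exact hn (by linear_combination hb)
  · refine hil (h2.mp ?_)
    rw [← sq_eq_zero_iff, two_y_add_sq h'.1, ← h1]
    simp [WeierstrassCurve.baseChange, map_ofNat (algebraMap R F)]

/-- The numerator and the denominator of the sum have no common zero. -/
lemma eval_translateNum_ne_zero [IsDomain R] [FaithfulSMul R F] (H : IsIntegralCycle W A l a b)
    {i : ℕ} (hi : i ∈ Icc 1 (l / 2)) : (translateNum W l a b).eval (a i) ≠ 0 := by
  have hii : (pairDen l a i).eval (a i) = 0 := by
    unfold pairDen
    split_ifs <;> simp
  have hval : (translateNum W l a b).eval (a i) = (pairNum W l a b i).eval (a i) *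
      ∏ j ∈ (Icc 1 (l / 2)).erase i, (pairDen l a j).eval (a i) := by
    rw [translateNum, translateRem, translateDen, eval_add, eval_mul, eval_prod,
      prod_eq_zero hi hii, mul_zero, zero_add, eval_finsetSum, sum_eq_single i]
    · rw [eval_mul, eval_prod]
    · intro j _ hj
      rw [eval_mul, eval_prod, prod_eq_zero (mem_erase.mpr ⟨hj.symm, hi⟩) hii, mul_zero]
    · exact fun h ↦ absurd hi h
  rw [hval]
  refine mul_ne_zero (H.eval_pairNum_ne_zero hi) (prod_ne_zero_iff.mpr fun j hj ↦ ?_)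
  obtain ⟨hji, hj⟩ := mem_erase.mp hj
  have : a i - a j ≠ 0 := sub_ne_zero.mpr fun h ↦ hji (H.a_injOn hi hj h).symm
  unfold pairDen
  split_ifs <;> simpa using this

end IsIntegralCycle

end TranslateSum

/-! ### The fibre over a transcendental sum -/

section Fiber

open scoped Classical

open Finset IntermediateField
open WeierstrassCurve.Affine (Point)

variable {R : Type*} [CommRing R] {F : Type*} [Field F] [Algebra R F]
  {W : WeierstrassCurve R} {A : (W.baseChange F).toAffine.Point} {l : ℕ} {a b : ℕ → R}

namespace IsIntegralCycle

/-- The numerator and the denominator of the sum are relatively prime: an irreducible factor of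
the denominator is one of the `X - a i`. -/
lemma isRelPrime_translateDen_translateNum [IsDomain R] [UniqueFactorizationMonoid R]
    [FaithfulSMul R F]
    (H : IsIntegralCycle W A l a b) : IsRelPrime (translateDen l a) (translateNum W l a b) := by
  refine WfDvdMonoid.isRelPrime_of_no_irreducible_factors
    (fun h ↦ (monic_translateDen l a).ne_zero h.1) fun d hd hg hf ↦ ?_
  obtain ⟨i, hi, hdi⟩ := (hd.prime.dvd_finsetProd_iff _).mp hg
  have hdi' : d ∣ X - C (a i) := by
    unfold pairDen at hdi
    split_ifs at hdi
    · exact hdi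
    · exact hd.prime.dvd_of_dvd_pow hdi
  have hX : X - C (a i) ∣ translateNum W l a b :=
    ((hd.dvd_symm (irreducible_X_sub_C (a i)) hdi').trans hf)
  exact H.eval_translateNum_ne_zero hi (dvd_iff_isRoot.mp hX)

/-- `fiberPoly` has degree one in `n`, with relatively prime coefficients. -/
lemma irreducible_fiberPoly [IsDomain R] [UniqueFactorizationMonoid R]
    [FaithfulSMul R F]
    (H : IsIntegralCycle W A l a b) : Irreducible (fiberPoly W l a b) := by
  have hswap : Bivariate.swap (fiberPoly W l a b) =
      C (-translateDen l a) * X + C (translateNum W l a b) := by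
    rw [fiberPoly, map_sub, map_mul, Bivariate.swap_map_C, Bivariate.swap_map_C, Bivariate.swap_X,
      C_neg]
    ring
  rw [← MulEquiv.irreducible_iff (Bivariate.swap (R := R)), hswap]
  exact irreducible_C_mul_X_add_C (neg_ne_zero.mpr (monic_translateDen l a).ne_zero)
    H.isRelPrime_translateDen_translateNum.neg_left

lemma xCoord_eq_of_mem_zmultiples (H : IsIntegralCycle W A l a b)
    {Q : (W.baseChange F).toAffine.Point} (hQ : Q ∈ AddSubgroup.zmultiples A) (hQ0 : Q ≠ 0) :
    ∃ i ∈ Icc 1 (l / 2), xCoord Q = algebraMap R F (a i) := by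
  have h3 := H.three_le
  have hfin : IsOfFinAddOrder A := addOrderOf_pos_iff.mp (by rw [H.addOrderOf_eq]; omega)
  obtain ⟨k, hk, rfl⟩ := Finset.mem_image.mp (hfin.mem_zmultiples_iff_mem_range_addOrderOf.mp hQ)
  rw [mem_range, H.addOrderOf_eq] at hk
  have hk0 : k ≠ 0 := by
    rintro rfl
    exact hQ0 (zero_nsmul A)
  by_cases hk2 : k ≤ l / 2
  · have hm : k ∈ Icc 1 (l / 2) := mem_Icc.mpr (by omega)
    obtain ⟨h', hA⟩ := H.nsmul_eq k hm
    exact ⟨k, hm, by rw [hA, xCoord]⟩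
  · have hm : l - k ∈ Icc 1 (l / 2) := mem_Icc.mpr (by omega)
    obtain ⟨h', hA⟩ := H.nsmul_eq _ hm
    rw [H.sub_nsmul hk.le] at hA
    exact ⟨_, hm, by rw [← xCoord_neg, hA, xCoord]⟩

lemma notMem_of_two_nsmul_notMem {P : (W.baseChange F).toAffine.Point}
    (h : (2 : ℕ) • P ∉ AddSubgroup.zmultiples A) :
    P ∉ AddSubgroup.zmultiples A := fun h' ↦ h (nsmul_mem h' 2)

lemma xCoord_add_nsmul_injOn (H : IsIntegralCycle W A l a b)
    {P : (W.baseChange F).toAffine.Point}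
    (h2 : (2 : ℕ) • P ∉ AddSubgroup.zmultiples A) {i j : ℕ} (hi : i < l) (hj : j < l)
    (h : xCoord (P + i • A) = xCoord (P + j • A)) : i = j := by
  have hP := notMem_of_two_nsmul_notMem h2
  have hne (k : ℕ) : P + k • A ≠ 0 := fun h0 ↦ hP <| by
    rw [eq_neg_of_add_eq_zero_left h0]
    exact neg_mem (nsmul_mem (AddSubgroup.mem_zmultiples A) k)
  rcases eq_or_eq_neg_of_xCoord_eq (hne i) (hne j) h with h0 | h0
  · have := (nsmul_inj_mod (x := A)).mp (add_left_cancel h0)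
    rwa [H.addOrderOf_eq, Nat.mod_eq_of_lt hi, Nat.mod_eq_of_lt hj] at this
  · refine absurd ?_ h2
    have : (2 : ℕ) • P = -((i + j) • A) := by
      rw [add_nsmul, two_nsmul, eq_neg_iff_add_eq_zero, ← sub_eq_zero.mpr h0]
      abel
    rw [this]
    exact neg_mem (nsmul_mem (AddSubgroup.mem_zmultiples A) _)

lemma translateSum_add_nsmul (H : IsIntegralCycle W A l a b)
    (P : (W.baseChange F).toAffine.Point) (k : ℕ) :
    translateSum A (P + k • A) l = translateSum A P l := by
  induction k with
  | zero => rw [zero_nsmul, add_zero]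
  | succ k ih =>
    rw [← ih, translateSum, translateSum]
    have h3 := H.three_le
    obtain ⟨m, rfl⟩ : ∃ m, l = m + 1 := ⟨l - 1, by omega⟩
    rw [sum_range_succ, sum_range_succ']
    congr 1
    · refine sum_congr rfl fun i _ ↦ ?_
      congr 1
      simp only [add_nsmul, one_nsmul]
      abel
    · have h0 : (m + 1) • A = 0 := by rw [← H.addOrderOf_eq, addOrderOf_nsmul_eq_zero]
      rw [add_assoc, ← add_nsmul, show k + 1 + m = k + (m + 1) by ring, add_nsmul A k, h0,
        zero_nsmul, add_zero, add_zero]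

variable [Algebra R[X] F] [IsScalarTower R R[X] F]

lemma eval_map_fiberPoly (x : F) :
    ((fiberPoly W l a b).map (algebraMap R[X] F)).eval x =
      aeval x (translateNum W l a b) - algebraMap R[X] F X * aeval x (translateDen l a) := by
  have hC : (algebraMap R[X] F).comp C = algebraMap R F :=
    (IsScalarTower.algebraMap_eq R R[X] F).symm
  rw [fiberPoly, Polynomial.map_sub, Polynomial.map_mul, Polynomial.map_map, Polynomial.map_map, hC,
    Polynomial.map_C, eval_sub, eval_mul, eval_C, eval_map_algebraMap, eval_map_algebraMap]

lemma translateSum_eq_iff (H : IsIntegralCycle W A l a b) {P : (W.baseChange F).toAffine.Point}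
    (hP : P ∉ AddSubgroup.zmultiples A) :
    translateSum A P l = algebraMap R[X] F X ↔
      ((fiberPoly W l a b).map (algebraMap R[X] F)).eval (xCoord P) = 0 := by
  obtain ⟨x, y, h, rfl, hx⟩ := H.exists_eq_some hP
  rw [eval_map_fiberPoly, xCoord, ← H.translateSum_mul (h := h) hx, ← sub_mul, mul_eq_zero,
    or_iff_left (aeval_translateDen_ne_zero hx), sub_eq_zero]

lemma exists_translateSum_eq [IsDomain R] [FaithfulSMul R[X] F] [IsAlgClosed F]
    (H : IsIntegralCycle W A l a b)
    (hΔ : (W.baseChange F).Δ ≠ 0) : ∃ P : (W.baseChange F).toAffine.Point,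
      P ∉ AddSubgroup.zmultiples A ∧ translateSum A P l = algebraMap R[X] F X := by
  have : FaithfulSMul R F := .trans R R[X] F
  have h3 := H.three_le
  have hdeg : ((fiberPoly W l a b).map (algebraMap R[X] F)).natDegree = l := by
    rw [(monic_fiberPoly W l a b).natDegree_map, natDegree_fiberPoly W l a b (by omega)]
  obtain ⟨x, hx⟩ := IsAlgClosed.exists_root ((fiberPoly W l a b).map (algebraMap R[X] F))
    fun h ↦ by
      have h0 : _ = 0 := natDegree_eq_of_degree_eq_some h
      omega
  have hxa (i : ℕ) (hi : i ∈ Icc 1 (l / 2)) : x ≠ algebraMap R F (a i) := by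
    rintro rfl
    rw [IsRoot, eval_map_fiberPoly, aeval_algebraMap_apply, aeval_algebraMap_apply] at hx
    have hden : aeval (a i) (translateDen l a) = 0 := by
      rw [translateDen, map_prod]
      refine prod_eq_zero hi ?_
      unfold pairDen
      split_ifs <;> simp
    rw [hden, map_zero, mul_zero, sub_zero, FaithfulSMul.algebraMap_eq_zero_iff] at hx
    exact H.eval_translateNum_ne_zero hi hx
  obtain ⟨y, hy⟩ : ∃ y, (W.baseChange F).toAffine.Equation x y := by
    obtain ⟨y, hy⟩ := IsAlgClosed.exists_root ((W.baseChange F).toAffine.polynomial.map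
      (evalRingHom x)) (by
        rw [degree_map_eq_of_leadingCoeff_ne_zero, WeierstrassCurve.Affine.degree_polynomial]
        · decide
        · simp [WeierstrassCurve.Affine.monic_polynomial.leadingCoeff])
    refine ⟨y, ?_⟩
    rwa [IsRoot, map_evalRingHom_eval] at hy
  have hns := (WeierstrassCurve.Affine.equation_iff_nonsingular_of_Δ_ne_zero hΔ).mp hy
  have hP : Point.some x y hns ∉ AddSubgroup.zmultiples A := by
    intro hP
    obtain ⟨i, hi, hxi⟩ := H.xCoord_eq_of_mem_zmultiples hP (Point.some_ne_zero hns)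
    exact hxa i hi hxi
  exact ⟨_, hP, (H.translateSum_eq_iff hP).mpr hx⟩

/-- Every element of `K(x(P))` is a quotient of polynomials in `x(P)` with coefficients in `R`,
because `n` is. -/
lemma exists_mul_aeval_eq {K : Type*} [Field K] [Algebra K F] [Algebra R[X] K]
    [IsScalarTower R[X] K F] [IsFractionRing R[X] K] {P : (W.baseChange F).toAffine.Point}
    (H : IsIntegralCycle W A l a b)
    (hP : P ∉ AddSubgroup.zmultiples A) (hn : translateSum A P l = algebraMap R[X] F X)
    {z : F} (hz : z ∈ K⟮xCoord P⟯) :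
    ∃ r s : R[X], aeval (xCoord P) s ≠ 0 ∧ z * aeval (xCoord P) s = aeval (xCoord P) r := by
  let S : Subring F := (aeval (R := R) (xCoord P)).toRingHom.range
  let L : Subfield F := Subfield.closure (S : Set F)
  have hmem (q : R[X]) : aeval (xCoord P) q ∈ L := Subfield.subset_closure ⟨q, rfl⟩
  have hnL : algebraMap R[X] F X ∈ L := by
    obtain ⟨x, y, h, rfl, hx⟩ := H.exists_eq_some hP
    rw [← hn, eq_div_of_mul_eq (aeval_translateDen_ne_zero hx) (H.translateSum_mul hx)]
    exact div_mem (hmem _) (hmem _)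
  have hRL (q : R[X]) : algebraMap R[X] F q ∈ L := by
    induction q using Polynomial.induction_on' with
    | add p q hp hq => rw [map_add]; exact add_mem hp hq
    | monomial k r =>
      rw [← C_mul_X_pow_eq_monomial, map_mul, map_pow]
      refine mul_mem ?_ (pow_mem hnL k)
      have := hmem (C r)
      rwa [aeval_C, IsScalarTower.algebraMap_apply R R[X] F] at this
  have hle : (K⟮xCoord P⟯).toSubfield ≤ L := by
    rw [IntermediateField.adjoin_toSubfield, Subfield.closure_le]
    rintro _ (⟨k, rfl⟩ | rfl)
    · obtain ⟨p, q, -, rfl⟩ := IsFractionRing.div_surjective (A := R[X]) k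
      rw [map_div₀, ← IsScalarTower.algebraMap_apply, ← IsScalarTower.algebraMap_apply]
      exact div_mem (hRL p) (hRL q)
    · have := hmem X
      rwa [aeval_X] at this
  obtain ⟨u, hu, v, hv, rfl⟩ := Subfield.mem_closure_iff.mp (hle hz)
  rw [Subring.closure_eq S] at hu hv
  obtain ⟨r, rfl⟩ := hu
  obtain ⟨s, rfl⟩ := hv
  by_cases hs : aeval (xCoord P) s = 0
  · exact ⟨0, 1, by simp, by simp [hs]⟩
  · exact ⟨r, s, hs, div_mul_cancel₀ _ hs⟩

section Generic

variable [IsDomain R] [FaithfulSMul R[X] F] {P : (W.baseChange F).toAffine.Point}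

/-- The abscissa of a point with transcendental sum is itself transcendental. -/
lemma transcendental_xCoord (H : IsIntegralCycle W A l a b)
    (hP : P ∉ AddSubgroup.zmultiples A) (hn : translateSum A P l = algebraMap R[X] F X) :
    Transcendental R (xCoord P) := by
  have : FaithfulSMul R F := .trans R R[X] F
  have htr : Transcendental R (algebraMap R[X] F X) :=
    (transcendental_algebraMap_iff (FaithfulSMul.algebraMap_injective R[X] F)).mpr
      (transcendental_X R)
  obtain ⟨x, y, h, rfl, hx⟩ := H.exists_eq_some hP
  intro halg
  refine htr ?_
  have haeval (q : R[X]) : IsAlgebraic R (aeval x q) :=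
    Algebra.adjoin_le (S := Subalgebra.algebraicClosure R F) (Set.singleton_subset_iff.mpr halg)
      (aeval_mem_adjoin_singleton R x)
  have hsum := H.translateSum_mul (h := h) hx
  rw [hn, ← eq_div_iff (aeval_translateDen_ne_zero hx), div_eq_mul_inv] at hsum
  rw [hsum]
  exact (haeval _).mul (haeval _).inv

/-- If `2 P` were a multiple of `A`, the duplication formula would make `x(P)` algebraic. -/
lemma two_nsmul_notMem [CharZero R] (H : IsIntegralCycle W A l a b)
    (hP : P ∉ AddSubgroup.zmultiples A) (hn : translateSum A P l = algebraMap R[X] F X) :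
    (2 : ℕ) • P ∉ AddSubgroup.zmultiples A := by
  have htr := H.transcendental_xCoord hP hn
  obtain ⟨x, y, h, rfl, hx⟩ := H.exists_eq_some hP
  rw [xCoord] at htr
  intro hmem
  by_cases h0 : (2 : ℕ) • Point.some x y h = 0
  · refine htr ⟨C 4 * X ^ 3 + C W.b₂ * X ^ 2 + C (2 * W.b₄) * X + C W.b₆, fun hq ↦ ?_, ?_⟩
    · have := congrArg (coeff · 3) hq
      simp at this
    · have := two_y_add_sq h.1
      rw [(two_y_add_eq_zero_iff h).mpr h0] at this
      simpa [WeierstrassCurve.baseChange, map_ofNat (algebraMap R F)] using this.symm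
  · obtain ⟨i, hi, hxi⟩ := H.xCoord_eq_of_mem_zmultiples hmem h0
    have hdup := xCoord_two_nsmul h h0
    rw [hxi] at hdup
    refine htr ⟨X ^ 4 - C W.b₄ * X ^ 2 - C (2 * W.b₆) * X - C W.b₈ -
      C (a i) * (C 4 * X ^ 3 + C W.b₂ * X ^ 2 + C (2 * W.b₄) * X + C W.b₆), fun hq ↦ ?_, ?_⟩
    · have := congrArg (coeff · 4) hq
      simp at this
    · simp [WeierstrassCurve.baseChange] at hdup
      simp [map_ofNat (algebraMap R F)]
      linear_combination -hdup

/-- `fiberPoly` is the polynomial whose roots are the abscissas of the translates. -/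
lemma map_fiberPoly_eq_translatePoly [CharZero R] (H : IsIntegralCycle W A l a b)
    (hP : P ∉ AddSubgroup.zmultiples A) (hn : translateSum A P l = algebraMap R[X] F X) :
    (fiberPoly W l a b).map (algebraMap R[X] F) = translatePoly A P l := by
  have h2 := H.two_nsmul_notMem hP hn
  have h3 := H.three_le
  have hmon : (translatePoly A P l).Monic := monic_prod_of_monic _ _ fun i _ ↦ monic_X_sub_C _
  refine eq_of_monic_of_dvd_of_natDegree_le hmon ((monic_fiberPoly W l a b).map _) ?_ ?_
  · refine Finset.prod_dvd_of_coprime (fun i hi j hj hij ↦ ?_) fun i _ ↦ ?_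
    · rw [coe_range, Set.mem_Iio] at hi hj
      exact isCoprime_X_sub_C_of_isUnit_sub
        (sub_ne_zero.mpr fun h ↦ hij (H.xCoord_add_nsmul_injOn h2 hi hj h)).isUnit
    · rw [dvd_iff_isRoot, IsRoot, ← H.translateSum_eq_iff, H.translateSum_add_nsmul, hn]
      rwa [add_mem_cancel_right (nsmul_mem (AddSubgroup.mem_zmultiples A) i)]
  · rw [(monic_fiberPoly W l a b).natDegree_map, natDegree_fiberPoly W l a b (by omega),
      translatePoly, natDegree_finsetProd_X_sub_C_eq_card, card_range]

/-- The points with the same sum as `P` are the points `±P + iA`. -/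
lemma exists_eq_or_eq_neg [CharZero R] (H : IsIntegralCycle W A l a b)
    (hP : P ∉ AddSubgroup.zmultiples A) (hn : translateSum A P l = algebraMap R[X] F X)
    {Q : (W.baseChange F).toAffine.Point} (hQ : Q ∉ AddSubgroup.zmultiples A)
    (hn' : translateSum A Q l = algebraMap R[X] F X) :
    ∃ i < l, Q = P + i • A ∨ Q = -(P + i • A) := by
  have h0 := (H.translateSum_eq_iff hQ).mp hn'
  rw [H.map_fiberPoly_eq_translatePoly hP hn, translatePoly, eval_prod, prod_eq_zero_iff] at h0
  obtain ⟨i, hi, h0⟩ := h0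
  rw [eval_sub, eval_X, eval_C, sub_eq_zero] at h0
  refine ⟨i, mem_range.mp hi, eq_or_eq_neg_of_xCoord_eq ?_ ?_ h0⟩
  · rintro rfl
    exact hQ (zero_mem _)
  · intro h
    refine hP ((add_mem_cancel_right (nsmul_mem (AddSubgroup.mem_zmultiples A) i)).mp ?_)
    rw [h]
    exact zero_mem _

end Generic

end IsIntegralCycle

end Fiber

/-! ### Dihedral translates in an abelian group -/

section DihedralTranslate

variable {G : Type*} [AddCommGroup G] {l : ℕ}

/-- The translates `P + τ j` and `-P + τ j` of a point `P`, indexed by the dihedral group. -/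
def dihedralTranslate (τ : ZMod l →+ G) (P : G) : DihedralGroup l → G
  | .r j => P + τ j
  | .sr j => -P + τ j

lemma dihedralTranslate_injective {τ : ZMod l →+ G} (hτ : Function.Injective τ) {P : G}
    (hP : (2 : ℕ) • P ∉ τ.range) : Function.Injective (dihedralTranslate τ P) := by
  have hne (i j : ZMod l) : P + τ i ≠ -P + τ j := fun h ↦ hP ⟨j - i, by
    rw [map_sub, two_nsmul, sub_eq_iff_eq_add, add_assoc, h, add_neg_cancel_left]⟩
  rintro (i | i) (j | j) h
  · exact congrArg _ (hτ (add_left_cancel h))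
  · exact absurd h (hne i j)
  · exact absurd h.symm (hne j i)
  · exact congrArg _ (hτ (add_left_cancel h))

lemma map_dihedralTranslate {τ : ZMod l →+ G} {P : G} {f : G →+ G} (hf : ∀ j, f (τ j) = τ j)
    {d : DihedralGroup l} (hd : f P = dihedralTranslate τ P d) (e : DihedralGroup l) :
    f (dihedralTranslate τ P e) = dihedralTranslate τ P (d * e) := by
  rcases d with i | i <;> rcases e with j | j <;>
    simp only [dihedralTranslate] at hd <;>
    simp only [dihedralTranslate, map_add, map_neg, hf, hd, DihedralGroup.r_mul_r,
      DihedralGroup.r_mul_sr, DihedralGroup.sr_mul_r, DihedralGroup.sr_mul_sr, map_sub] <;>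
    abel

/-- A subgroup of the dihedral group that contains a reflection, and each rotation up to
composition with a reflection, is the whole group. -/
lemma subgroup_dihedral_eq_top {S : Subgroup (DihedralGroup l)} (h0 : .sr 0 ∈ S)
    (h : ∀ i : ZMod l, .r i ∈ S ∨ .sr (-i) ∈ S) : S = ⊤ := by
  have hr (i : ZMod l) : DihedralGroup.r i ∈ S := by
    rcases h i with hi | hi
    · exact hi
    · have := S.inv_mem (S.mul_mem h0 hi)
      rwa [DihedralGroup.sr_mul_sr, DihedralGroup.inv_r, sub_zero, neg_neg] at this
  rw [eq_top_iff]
  rintro (i | i) -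
  · exact hr i
  · have := S.mul_mem h0 (hr i)
    rwa [DihedralGroup.sr_mul_r, zero_add] at this

end DihedralTranslate

/-! ### The Galois group -/

section Galois

open scoped Classical

open Finset IntermediateField
open WeierstrassCurve.Affine (Point)

variable {R : Type*} [CommRing R] {K F : Type*} [Field K] [Field F] [Algebra R F]
  [Algebra K F] [Algebra R K] [IsScalarTower R K F]
  {W : WeierstrassCurve R} {A : (W.baseChange F).toAffine.Point} {l : ℕ} {a b : ℕ → R}

/-- The action of an automorphism of `F` on the points of a curve defined over `R`. -/
noncomputable def galPoint (W : WeierstrassCurve R) (σ : F ≃ₐ[K] F) :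
    (W.baseChange F).toAffine.Point →+ (W.baseChange F).toAffine.Point :=
  Point.map (W' := W.toAffine) (S := K) σ.toAlgHom

lemma galPoint_some (σ : F ≃ₐ[K] F) {x y : F} (h : (W.baseChange F).toAffine.Nonsingular x y) :
    ∃ h', galPoint W σ (Point.some x y h) = Point.some (σ x) (σ y) h' :=
  ⟨_, rfl⟩

lemma xCoord_galPoint (σ : F ≃ₐ[K] F) (P : (W.baseChange F).toAffine.Point) :
    xCoord (galPoint W σ P) = σ (xCoord P) := by
  rcases P with _ | ⟨x, y, h⟩
  · exact (map_zero σ).symm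
  · rfl

lemma galPoint_mul (σ τ : F ≃ₐ[K] F) (P : (W.baseChange F).toAffine.Point) :
    galPoint W (σ * τ) P = galPoint W σ (galPoint W τ P) := by
  rcases P with _ | ⟨x, y, h⟩ <;> rfl

lemma galPoint_injective (σ : F ≃ₐ[K] F) : Function.Injective (galPoint W σ) :=
  Point.map_injective _

namespace IsIntegralCycle

lemma galPoint_eq (H : IsIntegralCycle W A l a b) (σ : F ≃ₐ[K] F) : galPoint W σ A = A := by
  obtain ⟨h, hA⟩ := H.nsmul_eq 1 (mem_Icc.mpr (by have := H.three_le; omega))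
  rw [one_nsmul] at hA
  subst hA
  obtain ⟨h', hσ⟩ := galPoint_some σ h
  have hc (r : R) : σ (algebraMap R F r) = algebraMap R F r := by
    rw [IsScalarTower.algebraMap_apply R K F, AlgEquiv.commutes]
  simp only [hσ, hc]

/-- The multiples of `A`, indexed by `ℤ/l`. -/
noncomputable def multiples (H : IsIntegralCycle W A l a b) :
    ZMod l →+ (W.baseChange F).toAffine.Point :=
  ZMod.lift l ⟨zmultiplesHom _ A, by
    rw [zmultiplesHom_apply, natCast_zsmul, ← H.addOrderOf_eq, addOrderOf_nsmul_eq_zero]⟩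

lemma multiples_intCast (H : IsIntegralCycle W A l a b) (k : ℤ) : H.multiples k = k • A := by
  rw [multiples, ZMod.lift_coe, zmultiplesHom_apply]

lemma multiples_natCast (H : IsIntegralCycle W A l a b) (k : ℕ) : H.multiples k = k • A := by
  rw [← natCast_zsmul, ← H.multiples_intCast, Int.cast_natCast]

lemma multiples_injective (H : IsIntegralCycle W A l a b) : Function.Injective H.multiples := by
  rw [multiples, ZMod.lift_injective]
  intro m hm
  rwa [zmultiplesHom_apply, ← addOrderOf_dvd_iff_zsmul_eq_zero, H.addOrderOf_eq,
    ← ZMod.intCast_zmod_eq_zero_iff_dvd] at hm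

lemma range_multiples (H : IsIntegralCycle W A l a b) :
    H.multiples.range = AddSubgroup.zmultiples A := by
  ext Q
  rw [AddMonoidHom.mem_range, AddSubgroup.mem_zmultiples_iff]
  constructor
  · rintro ⟨j, rfl⟩
    obtain ⟨k, rfl⟩ := ZMod.intCast_surjective j
    exact ⟨k, (H.multiples_intCast k).symm⟩
  · rintro ⟨k, rfl⟩
    exact ⟨k, H.multiples_intCast k⟩

lemma galPoint_multiples (H : IsIntegralCycle W A l a b) (σ : F ≃ₐ[K] F) (j : ZMod l) :
    galPoint W σ (H.multiples j) = H.multiples j := by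
  obtain ⟨k, rfl⟩ := ZMod.intCast_surjective j
  rw [multiples_intCast, map_zsmul, H.galPoint_eq]

variable [IsDomain R] [CharZero R] [Algebra R[X] F] [IsScalarTower R R[X] F] [FaithfulSMul R[X] F]
  [Algebra R[X] K] [IsScalarTower R[X] K F] {P : (W.baseChange F).toAffine.Point}

/-- An automorphism of `F` over `K` maps `P` to a point with the same sum. -/
lemma exists_galPoint_eq (H : IsIntegralCycle W A l a b)
    (hP : P ∉ AddSubgroup.zmultiples A) (hn : translateSum A P l = algebraMap R[X] F X)
    (σ : F ≃ₐ[K] F) :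
    ∃ d : DihedralGroup l, galPoint W σ P = dihedralTranslate H.multiples P d := by
  have hσP : galPoint W σ P ∉ AddSubgroup.zmultiples A := by
    rintro ⟨k, hk⟩
    refine hP ⟨k, galPoint_injective σ ?_⟩
    simpa [H.galPoint_eq] using hk
  have hσn : translateSum A (galPoint W σ P) l = algebraMap R[X] F X := by
    have h1 : translateSum A (galPoint W σ P) l = σ (translateSum A P l) := by
      rw [translateSum, translateSum, map_sum]
      refine sum_congr rfl fun i _ ↦ ?_
      rw [← xCoord_galPoint, map_add, map_nsmul, H.galPoint_eq]
    rw [h1, hn, IsScalarTower.algebraMap_apply R[X] K F, AlgEquiv.commutes]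
  obtain ⟨i, -, h | h⟩ := H.exists_eq_or_eq_neg hP hn hσP hσn
  · exact ⟨.r i, by rw [h, dihedralTranslate, multiples_natCast]⟩
  · exact ⟨.sr (-i), by rw [h, dihedralTranslate, map_neg, multiples_natCast, neg_add]⟩

/-- The action of the Galois group on the points `±P + iA` over `n`. -/
noncomputable def galToDihedral (H : IsIntegralCycle W A l a b)
    (hP : P ∉ AddSubgroup.zmultiples A) (hn : translateSum A P l = algebraMap R[X] F X) :
    (F ≃ₐ[K] F) →* DihedralGroup l :=
  have hinj : Function.Injective (dihedralTranslate H.multiples P) :=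
    dihedralTranslate_injective H.multiples_injective
      (by rw [H.range_multiples]; exact H.two_nsmul_notMem hP hn)
  .mk' (fun σ ↦ (H.exists_galPoint_eq hP hn σ).choose) fun σ τ ↦ hinj (by
    refine (H.exists_galPoint_eq hP hn (σ * τ)).choose_spec.symm.trans ?_
    refine (galPoint_mul σ τ P).trans ?_
    refine (congrArg _ (H.exists_galPoint_eq hP hn τ).choose_spec).trans ?_
    exact map_dihedralTranslate (H.galPoint_multiples σ)
      (H.exists_galPoint_eq hP hn σ).choose_spec _)

lemma galPoint_eq_dihedralTranslate (H : IsIntegralCycle W A l a b)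
    (hP : P ∉ AddSubgroup.zmultiples A) (hn : translateSum A P l = algebraMap R[X] F X)
    (σ : F ≃ₐ[K] F) :
    galPoint W σ P = dihedralTranslate H.multiples P (H.galToDihedral hP hn σ) :=
  (H.exists_galPoint_eq hP hn σ).choose_spec

lemma galToDihedral_eq_iff (H : IsIntegralCycle W A l a b)
    (hP : P ∉ AddSubgroup.zmultiples A) (hn : translateSum A P l = algebraMap R[X] F X)
    (σ : F ≃ₐ[K] F) (d : DihedralGroup l) :
    H.galToDihedral hP hn σ = d ↔ galPoint W σ P = dihedralTranslate H.multiples P d := by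
  rw [H.galPoint_eq_dihedralTranslate hP hn σ]
  exact (dihedralTranslate_injective H.multiples_injective
    (by rw [H.range_multiples]; exact H.two_nsmul_notMem hP hn)).eq_iff.symm

/-- An automorphism fixes `P` if and only if it fixes the abscissas of all translates of `P`. -/
lemma galToDihedral_eq_one_iff (H : IsIntegralCycle W A l a b)
    (hP : P ∉ AddSubgroup.zmultiples A) (hn : translateSum A P l = algebraMap R[X] F X)
    (σ : F ≃ₐ[K] F) :
    H.galToDihedral hP hn σ = 1 ↔ ∀ i < l, σ (xCoord (P + i • A)) = xCoord (P + i • A) := by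
  have h3 := H.three_le
  rw [galToDihedral_eq_iff, DihedralGroup.one_def, dihedralTranslate, map_zero, add_zero]
  constructor
  · intro h i _
    rw [← xCoord_galPoint, map_add, map_nsmul, H.galPoint_eq, h]
  · intro h
    have hcases (i : ℕ) (hi : i < l) :
        galPoint W σ P + i • A = P + i • A ∨ galPoint W σ P + i • A = -(P + i • A) := by
      have hne : P + i • A ≠ 0 := fun h0 ↦ hP <| by
        rw [eq_neg_of_add_eq_zero_left h0]
        exact neg_mem (nsmul_mem (AddSubgroup.mem_zmultiples A) i)
      have himg : galPoint W σ (P + i • A) = galPoint W σ P + i • A := by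
        rw [map_add, map_nsmul, H.galPoint_eq]
      rw [← himg]
      refine eq_or_eq_neg_of_xCoord_eq ?_ hne ?_
      · exact fun h0 ↦ hne (galPoint_injective σ (h0.trans (map_zero _).symm))
      · rw [xCoord_galPoint, h i hi]
    rcases hcases 0 (by omega) with h0 | h0
    · simpa using h0
    -- If `σ P = -P`, then `σ (P + A) = -P + A` is `±(P + A)`, so that `2 P = 0` or `2 A = 0`.
    have h0 : galPoint W σ P = -P := by simpa using h0
    have h1 := hcases 1 (by omega)
    rw [h0, one_nsmul] at h1
    rcases h1 with h1 | h1
    · refine absurd ?_ (H.two_nsmul_notMem hP hn)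
      have : (2 : ℕ) • P = 0 := by
        rw [two_nsmul, ← neg_eq_iff_add_eq_zero]
        exact add_right_cancel h1
      rw [this]
      exact zero_mem _
    · have h2 : (2 : ℕ) • A = 0 := by
        rw [neg_add, add_right_inj, eq_neg_iff_add_eq_zero] at h1
        rw [two_nsmul, h1]
      have := Nat.le_of_dvd two_pos (addOrderOf_dvd_iff_nsmul_eq_zero.mpr h2)
      rw [H.addOrderOf_eq] at this
      omega

/-- Some automorphism maps `P` to `-P`: the ordinate of `P` is not in `K(x(P))`, because
`(2 y + a₁ x + a₃)²` is a polynomial in `x` of odd degree. -/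
lemma exists_galPoint_eq_neg [IsFractionRing R[X] K] [IsAlgClosure K F]
    (H : IsIntegralCycle W A l a b) (hP : P ∉ AddSubgroup.zmultiples A)
    (hn : translateSum A P l = algebraMap R[X] F X) :
    ∃ σ : F ≃ₐ[K] F, galPoint W σ P = -P := by
  have htr := H.transcendental_xCoord hP hn
  have hquot {z : F} := H.exists_mul_aeval_eq hP hn (K := K) (z := z)
  obtain ⟨x, y, h, rfl, hx⟩ := H.exists_eq_some hP
  rw [xCoord] at htr hquot
  have hy : y ∉ K⟮x⟯ := by
    intro hy
    obtain ⟨r, s, hs, hrs⟩ := hquot hy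
    set Ψ : R[X] := C 4 * X ^ 3 + C W.b₂ * X ^ 2 + C (2 * W.b₄) * X + C W.b₆ with hΨ
    have hΨdeg : Ψ.natDegree = 3 := natDegree_cubic (by norm_num)
    have hs0 : s ≠ 0 := by
      rintro rfl
      exact hs (map_zero _)
    have hΨ0 : Ψ ≠ 0 := by
      intro h0
      rw [h0, natDegree_zero] at hΨdeg
      omega
    have hpoly : (C 2 * r + (C W.a₁ * X + C W.a₃) * s) ^ 2 = Ψ * s ^ 2 := by
      refine transcendental_iff_injective.mp htr ?_
      have hsq := two_y_add_sq h.1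
      simp only [WeierstrassCurve.baseChange, WeierstrassCurve.map_a₁, WeierstrassCurve.map_a₃,
        WeierstrassCurve.map_b₂, WeierstrassCurve.map_b₄, WeierstrassCurve.map_b₆] at hsq
      simp only [hΨ, map_pow, map_add, map_mul, aeval_X, aeval_C, map_ofNat (algebraMap R F)]
      rw [← hsq, ← hrs]
      ring
    have hdeg := congrArg natDegree hpoly
    rw [natDegree_pow, natDegree_mul hΨ0 (pow_ne_zero 2 hs0), hΨdeg, natDegree_pow] at hdeg
    omega
  have : CharZero K := charZero_of_injective_algebraMap (IsFractionRing.injective R[X] K)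
  obtain ⟨σ, hσx, hσy⟩ : ∃ σ : F ≃ₐ[K] F, σ x = x ∧ σ y ≠ y := by
    by_contra! hall
    refine hy ?_
    rw [← InfiniteGalois.fixedField_fixingSubgroup K⟮x⟯, mem_fixedField_iff]
    intro σ hσ
    exact hall σ ((mem_fixingSubgroup_iff _ σ).mp hσ x (mem_adjoin_simple_self K x))
  refine ⟨σ, ?_⟩
  obtain ⟨h', hσ⟩ := galPoint_some σ h
  rw [hσ]
  refine (Point.X_eq_iff.mp hσx).resolve_left fun h0 ↦ hσy ?_
  rw [Point.some.injEq] at h0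
  exact h0.2

lemma galToDihedral_surjective [UniqueFactorizationMonoid R] [IsFractionRing R[X] K]
    [IsAlgClosure K F] (H : IsIntegralCycle W A l a b) (hP : P ∉ AddSubgroup.zmultiples A)
    (hn : translateSum A P l = algebraMap R[X] F X) :
    Function.Surjective (H.galToDihedral (K := K) hP hn) := by
  have : FaithfulSMul R F := .trans R R[X] F
  have h3 := H.three_le
  rw [← MonoidHom.range_eq_top]
  have hcomp : (algebraMap K F).comp (algebraMap R[X] K) = algebraMap R[X] F :=
    (IsScalarTower.algebraMap_eq R[X] K F).symm
  have hirr := (monic_fiberPoly W l a b).irreducible_iff_irreducible_map_fraction_map (K := K) |>.mp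
    H.irreducible_fiberPoly
  have hroot (i : ℕ) : aeval (xCoord (P + i • A))
      ((fiberPoly W l a b).map (algebraMap R[X] K)) = 0 := by
    rw [aeval_def, ← eval_map, Polynomial.map_map, hcomp, ← H.translateSum_eq_iff,
      H.translateSum_add_nsmul, hn]
    rwa [add_mem_cancel_right (nsmul_mem (AddSubgroup.mem_zmultiples A) i)]
  refine subgroup_dihedral_eq_top ?_ fun i ↦ ?_
  · obtain ⟨σ, hσ⟩ := H.exists_galPoint_eq_neg (K := K) hP hn
    exact ⟨σ, (H.galToDihedral_eq_iff hP hn σ _).mpr (by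
      rw [hσ, dihedralTranslate, map_zero, add_zero])⟩
  · have : NeZero l := ⟨by omega⟩
    have halg : IsAlgebraic K (xCoord P) :=
      (IsAlgClosure.isAlgebraic (R := K) (K := F)).isAlgebraic _
    have hmin : minpoly K (xCoord P) = (fiberPoly W l a b).map (algebraMap R[X] K) := by
      refine (minpoly.eq_of_irreducible_of_monic hirr ?_ ((monic_fiberPoly W l a b).map _)).symm
      simpa using hroot 0
    have : Normal K F := IsAlgClosure.normal K F
    obtain ⟨σ, hσ⟩ := minpoly.exists_algEquiv_of_root' halg
      (x := xCoord (P + i.val • A)) (by rw [hmin]; exact hroot _)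
    have hi : i.val • A = H.multiples i := by
      rw [← H.multiples_natCast, ZMod.natCast_zmod_val]
    have hne (k : ℕ) : P + k • A ≠ 0 := fun h0 ↦ hP <| by
      rw [eq_neg_of_add_eq_zero_left h0]
      exact neg_mem (nsmul_mem (AddSubgroup.mem_zmultiples A) k)
    have hσP : galPoint W σ P ≠ 0 := fun h0 ↦ hne 0 (galPoint_injective σ (by simpa using h0))
    rcases eq_or_eq_neg_of_xCoord_eq hσP (hne i.val) (by rw [xCoord_galPoint, hσ]) with h | h
    · exact .inl ⟨σ, (H.galToDihedral_eq_iff hP hn σ _).mpr (by rw [h, hi, dihedralTranslate])⟩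
    · exact .inr ⟨σ, (H.galToDihedral_eq_iff hP hn σ _).mpr (by
        rw [h, hi, dihedralTranslate, map_neg, neg_add])⟩

/-- The Galois group of `fiberPoly` over `K = Frac R[n]` is dihedral. -/
lemma nonempty_gal_mulEquiv [UniqueFactorizationMonoid R] [IsFractionRing R[X] K]
    [IsAlgClosure K F] (H : IsIntegralCycle W A l a b) (hP : P ∉ AddSubgroup.zmultiples A)
    (hn : translateSum A P l = algebraMap R[X] F X) :
    Nonempty (((fiberPoly W l a b).map (algebraMap R[X] K)).Gal ≃* DihedralGroup l) := by
  have : Normal K F := IsAlgClosure.normal K F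
  have : IsAlgClosed F := IsAlgClosure.isAlgClosed K
  set p := (fiberPoly W l a b).map (algebraMap R[X] K) with hp
  have hmap : p.map (algebraMap K F) = translatePoly A P l := by
    rw [hp, Polynomial.map_map, ← IsScalarTower.algebraMap_eq R[X] K F,
      H.map_fiberPoly_eq_translatePoly hP hn]
  have hp0 : p ≠ 0 := ((monic_fiberPoly W l a b).map _).ne_zero
  have : Fact ((p.map (algebraMap K F)).Splits) := ⟨IsAlgClosed.splits _⟩
  have hker : (Gal.restrict p F).ker = (H.galToDihedral (K := K) hP hn).ker := by
    ext σ
    rw [MonoidHom.mem_ker, MonoidHom.mem_ker, galToDihedral_eq_one_iff,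
      ← (Gal.galActionHom_injective p F).eq_iff, map_one, Equiv.ext_iff]
    have hroot (z : F) : z ∈ p.rootSet F ↔ ∃ i < l, z = xCoord (P + i • A) := by
      rw [mem_rootSet, and_iff_right hp0, aeval_def, ← eval_map, hmap, translatePoly, eval_prod,
        prod_eq_zero_iff]
      simp [sub_eq_zero]
    constructor
    · intro h i hi
      have := congrArg Subtype.val (h ⟨_, (hroot _).mpr ⟨i, hi, rfl⟩⟩)
      rwa [Gal.galActionHom_restrict] at this
    · rintro h ⟨z, hz⟩
      obtain ⟨i, hi, rfl⟩ := (hroot z).mp hz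
      refine Subtype.ext ?_
      rw [Gal.galActionHom_restrict]
      exact h i hi
  exact ⟨(QuotientGroup.quotientKerEquivOfSurjective _ (Gal.restrict_surjective p F)).symm.trans
    ((QuotientGroup.quotientMulEquivOfEq hker).trans
      (QuotientGroup.quotientKerEquivOfSurjective _ (H.galToDihedral_surjective hP hn)))⟩

end IsIntegralCycle

end Galois

/-! ### The multiples of `(0, 0)` on Kubert's curves -/

section Kubert

open scoped Classical

open Finset
open WeierstrassCurve.Affine (Point)

variable {R F : Type*} [CommRing R] [Field F] [Algebra R F]

/-- The point `i • A`, on the base change to `F` of a curve over `R`, has coordinates `(x, y)`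
in `R`. -/
def IsMultiple (W : WeierstrassCurve R) (A : (W.baseChange F).toAffine.Point) (i : ℕ) (x y : R) :
    Prop :=
  ∃ h, i • A = Point.some (algebraMap R F x) (algebraMap R F y) h

lemma exists_isIntegralCycle {W : WeierstrassCurve R} {A : (W.baseChange F).toAffine.Point} {l : ℕ}
    (h3 : 3 ≤ l) (h0 : l • A = 0) (h : ∀ i ∈ Icc 1 (l / 2), ∃ x y, IsMultiple W A i x y) :
    ∃ a b, IsIntegralCycle W A l a b := by
  have h' (i : ℕ) : ∃ x y, i ∈ Icc 1 (l / 2) → IsMultiple W A i x y := by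
    by_cases hi : i ∈ Icc 1 (l / 2)
    · obtain ⟨x, y, hxy⟩ := h i hi
      exact ⟨x, y, fun _ ↦ hxy⟩
    · exact ⟨0, 0, fun hi' ↦ absurd hi' hi⟩
  choose a b hab using h'
  refine ⟨a, b, h3, ?_, hab⟩
  -- The order divides `l`; a proper divisor of `l` is at most `l / 2`.
  obtain ⟨k, hk⟩ := addOrderOf_dvd_iff_nsmul_eq_zero.mpr h0
  have hpos : 1 ≤ addOrderOf A := Nat.one_le_iff_ne_zero.mpr fun hz ↦ by
    rw [hz, zero_mul] at hk
    omega
  by_cases hle : addOrderOf A ≤ l / 2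
  · obtain ⟨hns, hA⟩ := hab _ (mem_Icc.mpr ⟨hpos, hle⟩)
    rw [addOrderOf_nsmul_eq_zero] at hA
    exact absurd hA.symm (Point.some_ne_zero hns)
  · have hk1 : k = 1 := by
      rcases k with _ | _ | k
      · omega
      · rfl
      · have : addOrderOf A * 2 ≤ l := hk ▸ Nat.mul_le_mul_left _ (by omega)
        omega
    rw [hk1, mul_one] at hk
    exact hk.symm

namespace IsMultiple

variable {W : WeierstrassCurve R}

lemma add_eq_zero {A : (W.baseChange F).toAffine.Point} {i j : ℕ} {x y y' : R}
    (h : IsMultiple W A i x y) (h' : IsMultiple W A j x y') (hy : y = -y' - W.a₁ * x - W.a₃) :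
    (i + j) • A = 0 := by
  obtain ⟨k, hk⟩ := h
  obtain ⟨k', hk'⟩ := h'
  rw [add_nsmul, hk, hk']
  refine Point.add_of_Y_eq rfl ?_
  simp [hy, WeierstrassCurve.baseChange, WeierstrassCurve.Affine.negY]

variable {hA : (W.baseChange F).toAffine.Nonsingular 0 0}

lemma one : IsMultiple W (.some 0 0 hA) 1 0 0 := by
  refine ⟨by rwa [map_zero], ?_⟩
  rw [one_nsmul, Point.some.injEq, map_zero]
  exact ⟨rfl, rfl⟩

/-- The tangent at `(0, 0)` is horizontal if `a₄ = 0`. -/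
lemma two (h₄ : W.a₄ = 0) {x y : R} (hx : x = -W.a₂) (hy : y = W.a₁ * W.a₂ - W.a₃) :
    IsMultiple W (.some 0 0 hA) 2 x y := by
  have h₃ : (W.baseChange F).a₃ ≠ 0 := by
    have := (WeierstrassCurve.Affine.nonsingular_zero.mp hA).2
    simpa [WeierstrassCurve.baseChange, h₄] using this
  have hne : (0 : F) ≠ (W.baseChange F).toAffine.negY 0 0 := by
    simpa [WeierstrassCurve.Affine.negY] using h₃
  have key := Point.add_self_of_Y_ne (h₁ := hA) hne
  have hslope : (W.baseChange F).toAffine.slope 0 0 0 0 = 0 := by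
    rw [WeierstrassCurve.Affine.slope_of_Y_ne rfl hne]
    simp [WeierstrassCurve.baseChange, h₄]
  simp only [hslope, WeierstrassCurve.Affine.addX, WeierstrassCurve.Affine.addY,
    WeierstrassCurve.Affine.negAddY, WeierstrassCurve.Affine.negY] at key
  rw [IsMultiple, two_nsmul, key]
  have ex : algebraMap R F x = 0 ^ 2 + (W.baseChange F).a₁ * 0 - (W.baseChange F).a₂ - 0 - 0 := by
    simp [hx, WeierstrassCurve.baseChange]
  have ey : algebraMap R F y = -(0 * (0 ^ 2 + (W.baseChange F).a₁ * 0 - (W.baseChange F).a₂ - 0 - 0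
      - 0) + 0) - (W.baseChange F).a₁ * (0 ^ 2 + (W.baseChange F).a₁ * 0 - (W.baseChange F).a₂
      - 0 - 0) - (W.baseChange F).a₃ := by
    simp [hy, WeierstrassCurve.baseChange]
  rw [ex, ey]
  exact ⟨_, rfl⟩

/-- Adding `(0, 0)` to a point `(x, m x)`: the chord has slope `m`. -/
lemma succ [FaithfulSMul R F] {i : ℕ} {x y : R} (h : IsMultiple W (.some 0 0 hA) i x y) (m : R)
    {x' y' : R} (hx : x ≠ 0) (hm : y = m * x) (hx' : x' = m ^ 2 + W.a₁ * m - W.a₂ - x)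
    (hy' : y' = -(m * x') - W.a₁ * x' - W.a₃) : IsMultiple W (.some 0 0 hA) (i + 1) x' y' := by
  obtain ⟨k, hk⟩ := h
  have hx0 : algebraMap R F x ≠ 0 := by rwa [Ne, FaithfulSMul.algebraMap_eq_zero_iff]
  obtain ⟨k', hk'⟩ := some_add_some_of_slope k hA hx0 (m := algebraMap R F m) (by
    rw [hm, map_mul, sub_zero, sub_zero])
  rw [IsMultiple, add_nsmul, one_nsmul, hk, hk']
  have ex : algebraMap R F x' = algebraMap R F m ^ 2 + (W.baseChange F).a₁ * algebraMap R F m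
      - (W.baseChange F).a₂ - algebraMap R F x - 0 := by
    simp [hx', WeierstrassCurve.baseChange]
  have ey : algebraMap R F y' = -(algebraMap R F m * (algebraMap R F x' - algebraMap R F x) +
      algebraMap R F y) - (W.baseChange F).a₁ * algebraMap R F x' - (W.baseChange F).a₃ := by
    simp only [hy', hm, WeierstrassCurve.baseChange, WeierstrassCurve.map_a₁,
      WeierstrassCurve.map_a₃, map_sub, map_neg, map_mul]
    ring
  rw [ey, ex]
  exact ⟨_, rfl⟩

end IsMultiple

/-! For each `l` the multiples of `A = (0, 0)` are found by adding `A` repeatedly; all slopes are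
polynomials in `c`. The relation `l • A = 0` is read off from the points `i • A` and `(l - i) • A`
with `i = l / 2`. Nonvanishing of polynomials in the parameters is seen by specialising all
parameters to `3`, a value at which all curves of the family are nonsingular and the multiples of
`A` that are used, other than `A` itself, have nonzero abscissas. -/

variable {c a : R} {ev : R →+* ℤ}

lemma exists_isIntegralCycle_three
    {hA : ((kubertFamily 3 c a).baseChange F).toAffine.Nonsingular 0 0} :
    ∃ x y, IsIntegralCycle (kubertFamily 3 c a) (Point.some 0 0 hA) 3 x y := by
  have h1 := IsMultiple.one (hA := hA)
  have h2 : IsMultiple _ (.some 0 0 hA) 2 0 (-a) := .two rfl (by simp [kubertFamily])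
    (by simp [kubertFamily])
  refine exists_isIntegralCycle (by norm_num) (h1.add_eq_zero h2 (by simp [kubertFamily])) ?_
  intro i hi
  have hi₁ : 1 ≤ i := (mem_Icc.mp hi).1
  have hi₂ : i ≤ 1 := (mem_Icc.mp hi).2
  interval_cases i
  exact ⟨_, _, h1⟩

lemma exists_isIntegralCycle_four
    {hA : ((kubertFamily 4 c a).baseChange F).toAffine.Nonsingular 0 0} :
    ∃ x y, IsIntegralCycle (kubertFamily 4 c a) (Point.some 0 0 hA) 4 x y := by
  have h1 := IsMultiple.one (hA := hA)
  have h2 : IsMultiple _ (.some 0 0 hA) 2 (-c) (0) :=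
    .two rfl (by simp only [kubertFamily, tateCurve]; ring)
      (by simp only [kubertFamily, tateCurve]; ring)
  refine exists_isIntegralCycle (by norm_num)
    (h2.add_eq_zero h2 (by simp only [kubertFamily, tateCurve]; ring)) ?_
  intro i hi
  have hi₁ : 1 ≤ i := (mem_Icc.mp hi).1
  have hi₂ : i ≤ 2 := (mem_Icc.mp hi).2
  interval_cases i
  exacts [⟨_, _, h1⟩, ⟨_, _, h2⟩]

variable [FaithfulSMul R F]

lemma exists_isIntegralCycle_five (hc : ev c = 3)
    {hA : ((kubertFamily 5 c a).baseChange F).toAffine.Nonsingular 0 0} :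
    ∃ x y, IsIntegralCycle (kubertFamily 5 c a) (Point.some 0 0 hA) 5 x y := by
  have hne {z : R} (hz : ev z ≠ 0) : z ≠ 0 := fun h ↦ hz (by rw [h, map_zero])
  have h1 := IsMultiple.one (hA := hA)
  have h2 : IsMultiple _ (.some 0 0 hA) 2 (c) (c ^ 2) :=
    .two rfl (by simp only [kubertFamily, tateCurve]; ring)
      (by simp only [kubertFamily, tateCurve]; ring)
  have h3 : IsMultiple _ (.some 0 0 hA) 3 (c)
      (0) :=
    h2.succ (c) (hne (by simp [hc])) (by ring)
      (by simp only [kubertFamily, tateCurve]; ring)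
      (by simp only [kubertFamily, tateCurve]; ring)
  refine exists_isIntegralCycle (by norm_num)
    (h2.add_eq_zero h3 (by simp only [kubertFamily, tateCurve]; ring)) ?_
  intro i hi
  have hi₁ : 1 ≤ i := (mem_Icc.mp hi).1
  have hi₂ : i ≤ 2 := (mem_Icc.mp hi).2
  interval_cases i
  exacts [⟨_, _, h1⟩, ⟨_, _, h2⟩]

lemma exists_isIntegralCycle_six (hc : ev c = 3)
    {hA : ((kubertFamily 6 c a).baseChange F).toAffine.Nonsingular 0 0} :
    ∃ x y, IsIntegralCycle (kubertFamily 6 c a) (Point.some 0 0 hA) 6 x y := by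
  have hne {z : R} (hz : ev z ≠ 0) : z ≠ 0 := fun h ↦ hz (by rw [h, map_zero])
  have h1 := IsMultiple.one (hA := hA)
  have h2 : IsMultiple _ (.some 0 0 hA) 2 (c * (c + 1)) (c ^ 2 * (c + 1)) :=
    .two rfl (by simp only [kubertFamily, tateCurve]; ring)
      (by simp only [kubertFamily, tateCurve]; ring)
  have h3 : IsMultiple _ (.some 0 0 hA) 3 (c)
      (c ^ 2) :=
    h2.succ (c) (hne (by simp [hc])) (by ring)
      (by simp only [kubertFamily, tateCurve]; ring)
      (by simp only [kubertFamily, tateCurve]; ring)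
  refine exists_isIntegralCycle (by norm_num)
    (h3.add_eq_zero h3 (by simp only [kubertFamily, tateCurve]; ring)) ?_
  intro i hi
  have hi₁ : 1 ≤ i := (mem_Icc.mp hi).1
  have hi₂ : i ≤ 3 := (mem_Icc.mp hi).2
  interval_cases i
  exacts [⟨_, _, h1⟩, ⟨_, _, h2⟩, ⟨_, _, h3⟩]

lemma exists_isIntegralCycle_seven (hc : ev c = 3)
    {hA : ((kubertFamily 7 c a).baseChange F).toAffine.Nonsingular 0 0} :
    ∃ x y, IsIntegralCycle (kubertFamily 7 c a) (Point.some 0 0 hA) 7 x y := by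
  have hne {z : R} (hz : ev z ≠ 0) : z ≠ 0 := fun h ↦ hz (by rw [h, map_zero])
  have h1 := IsMultiple.one (hA := hA)
  have h2 : IsMultiple _ (.some 0 0 hA) 2 (c ^ 2 * (c - 1)) (c ^ 3 * (c - 1) ^ 2) :=
    .two rfl (by simp only [kubertFamily, tateCurve]; ring)
      (by simp only [kubertFamily, tateCurve]; ring)
  have h3 : IsMultiple _ (.some 0 0 hA) 3 (c * (c - 1))
      (c * (c - 1) ^ 2) :=
    h2.succ (c * (c - 1)) (hne (by simp [hc])) (by ring)
      (by simp only [kubertFamily, tateCurve]; ring)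
      (by simp only [kubertFamily, tateCurve]; ring)
  have h4 : IsMultiple _ (.some 0 0 hA) 4 (c * (c - 1))
      (c ^ 2 * (c - 1) ^ 2) :=
    h3.succ ((c - 1)) (hne (by simp [hc])) (by ring)
      (by simp only [kubertFamily, tateCurve]; ring)
      (by simp only [kubertFamily, tateCurve]; ring)
  refine exists_isIntegralCycle (by norm_num)
    (h3.add_eq_zero h4 (by simp only [kubertFamily, tateCurve]; ring)) ?_
  intro i hi
  have hi₁ : 1 ≤ i := (mem_Icc.mp hi).1
  have hi₂ : i ≤ 3 := (mem_Icc.mp hi).2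
  interval_cases i
  exacts [⟨_, _, h1⟩, ⟨_, _, h2⟩, ⟨_, _, h3⟩]

lemma exists_isIntegralCycle_eight (hc : ev c = 3)
    {hA : ((kubertFamily 8 c a).baseChange F).toAffine.Nonsingular 0 0} :
    ∃ x y, IsIntegralCycle (kubertFamily 8 c a) (Point.some 0 0 hA) 8 x y := by
  have hne {z : R} (hz : ev z ≠ 0) : z ≠ 0 := fun h ↦ hz (by rw [h, map_zero])
  have h1 := IsMultiple.one (hA := hA)
  have h2 : IsMultiple _ (.some 0 0 hA) 2
      (c ^ 2 * (c - 1) * (2 * c - 1))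
      (c ^ 2 * (c - 1) ^ 2 * (2 * c - 1) ^ 2) :=
    .two rfl (by simp only [kubertFamily, tateCurve]; ring)
      (by simp only [kubertFamily, tateCurve]; ring)
  have h3 : IsMultiple _ (.some 0 0 hA) 3 (c * (c - 1) * (2 * c - 1))
      (c ^ 2 * (c - 1) ^ 2 * (2 * c - 1)) :=
    h2.succ ((c - 1) * (2 * c - 1)) (hne (by simp [hc, map_ofNat ev]))
      (by ring)
      (by simp only [kubertFamily, tateCurve]; ring)
      (by simp only [kubertFamily, tateCurve]; ring)
  have h4 : IsMultiple _ (.some 0 0 hA) 4 (c ^ 3 * (c - 1))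
      (c ^ 4 * (c - 1) ^ 2) :=
    h3.succ (c * (c - 1)) (hne (by simp [hc, map_ofNat ev]))
      (by ring)
      (by simp only [kubertFamily, tateCurve]; ring)
      (by simp only [kubertFamily, tateCurve]; ring)
  refine exists_isIntegralCycle (by norm_num)
    (h4.add_eq_zero h4 (by simp only [kubertFamily, tateCurve]; ring)) ?_
  intro i hi
  have hi₁ : 1 ≤ i := (mem_Icc.mp hi).1
  have hi₂ : i ≤ 4 := (mem_Icc.mp hi).2
  interval_cases i
  exacts [⟨_, _, h1⟩, ⟨_, _, h2⟩, ⟨_, _, h3⟩, ⟨_, _, h4⟩]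

lemma exists_isIntegralCycle_nine (hc : ev c = 3)
    {hA : ((kubertFamily 9 c a).baseChange F).toAffine.Nonsingular 0 0} :
    ∃ x y, IsIntegralCycle (kubertFamily 9 c a) (Point.some 0 0 hA) 9 x y := by
  have hne {z : R} (hz : ev z ≠ 0) : z ≠ 0 := fun h ↦ hz (by rw [h, map_zero])
  have h1 := IsMultiple.one (hA := hA)
  have h2 : IsMultiple _ (.some 0 0 hA) 2
      (c ^ 2 * (c - 1) * (c ^ 2 - c + 1))
      (c ^ 4 * (c - 1) ^ 2 * (c ^ 2 - c + 1)) :=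
    .two rfl (by simp only [kubertFamily, tateCurve]; ring)
      (by simp only [kubertFamily, tateCurve]; ring)
  have h3 : IsMultiple _ (.some 0 0 hA) 3 (c ^ 2 * (c - 1))
      (c ^ 3 * (c - 1) ^ 2) :=
    h2.succ (c ^ 2 * (c - 1)) (hne (by simp [hc])) (by ring)
      (by simp only [kubertFamily, tateCurve]; ring)
      (by simp only [kubertFamily, tateCurve]; ring)
  have h4 : IsMultiple _ (.some 0 0 hA) 4 (c * (c - 1) * (c ^ 2 - c + 1))
      (c * (c - 1) ^ 2 * (c ^ 2 - c + 1) ^ 2) :=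
    h3.succ (c * (c - 1)) (hne (by simp [hc])) (by ring)
      (by simp only [kubertFamily, tateCurve]; ring)
      (by simp only [kubertFamily, tateCurve]; ring)
  have h5 : IsMultiple _ (.some 0 0 hA) 5 (c * (c - 1) * (c ^ 2 - c + 1))
      (c ^ 2 * (c - 1) ^ 2 * (c ^ 2 - c + 1)) :=
    h4.succ ((c - 1) * (c ^ 2 - c + 1)) (hne (by simp [hc])) (by ring)
      (by simp only [kubertFamily, tateCurve]; ring)
      (by simp only [kubertFamily, tateCurve]; ring)
  refine exists_isIntegralCycle (by norm_num)
    (h4.add_eq_zero h5 (by simp only [kubertFamily, tateCurve]; ring)) ?_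
  intro i hi
  have hi₁ : 1 ≤ i := (mem_Icc.mp hi).1
  have hi₂ : i ≤ 4 := (mem_Icc.mp hi).2
  interval_cases i
  exacts [⟨_, _, h1⟩, ⟨_, _, h2⟩, ⟨_, _, h3⟩, ⟨_, _, h4⟩]

lemma exists_isIntegralCycle_ten (hc : ev c = 3)
    {hA : ((kubertFamily 10 c a).baseChange F).toAffine.Nonsingular 0 0} :
    ∃ x y, IsIntegralCycle (kubertFamily 10 c a) (Point.some 0 0 hA) 10 x y := by
  have hne {z : R} (hz : ev z ≠ 0) : z ≠ 0 := fun h ↦ hz (by rw [h, map_zero])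
  have h1 := IsMultiple.one (hA := hA)
  have h2 : IsMultiple _ (.some 0 0 hA) 2
      (c ^ 3 * (c - 1) * (2 * c - 1))
      (c ^ 4 * (c - 1) ^ 2 * (2 * c - 1) ^ 2) :=
    .two rfl (by simp only [kubertFamily, tateCurve]; ring)
      (by simp only [kubertFamily, tateCurve]; ring)
  have h3 : IsMultiple _ (.some 0 0 hA) 3 (-c * (c - 1) * (2 * c - 1) * (c ^ 2 - 3 * c + 1))
      (-c * (c - 1) ^ 2 * (2 * c - 1) ^ 2 * (c ^ 2 - 3 * c + 1)) :=
    h2.succ (c * (c - 1) * (2 * c - 1)) (hne (by simp [hc, map_ofNat ev]))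
      (by ring)
      (by simp only [kubertFamily, tateCurve]; ring)
      (by simp only [kubertFamily, tateCurve]; ring)
  have h4 : IsMultiple _ (.some 0 0 hA) 4 (c ^ 2 * (c - 1) * (2 * c - 1))
      (c ^ 4 * (c - 1) ^ 2 * (2 * c - 1)) :=
    h3.succ ((c - 1) * (2 * c - 1)) (hne (by simp [hc, map_ofNat ev]))
      (by ring)
      (by simp only [kubertFamily, tateCurve]; ring)
      (by simp only [kubertFamily, tateCurve]; ring)
  have h5 : IsMultiple _ (.some 0 0 hA) 5 (-c ^ 3 * (c - 1) * (c ^ 2 - 3 * c + 1))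
      (-c ^ 5 * (c - 1) ^ 2 * (c ^ 2 - 3 * c + 1)) :=
    h4.succ (c ^ 2 * (c - 1)) (hne (by simp [hc, map_ofNat ev]))
      (by ring)
      (by simp only [kubertFamily, tateCurve]; ring)
      (by simp only [kubertFamily, tateCurve]; ring)
  refine exists_isIntegralCycle (by norm_num)
    (h5.add_eq_zero h5 (by simp only [kubertFamily, tateCurve]; ring)) ?_
  intro i hi
  have hi₁ : 1 ≤ i := (mem_Icc.mp hi).1
  have hi₂ : i ≤ 5 := (mem_Icc.mp hi).2
  interval_cases i
  exacts [⟨_, _, h1⟩, ⟨_, _, h2⟩, ⟨_, _, h3⟩, ⟨_, _, h4⟩, ⟨_, _, h5⟩]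

lemma exists_isIntegralCycle_twelve (hc : ev c = 3)
    {hA : ((kubertFamily 12 c a).baseChange F).toAffine.Nonsingular 0 0} :
    ∃ x y, IsIntegralCycle (kubertFamily 12 c a) (Point.some 0 0 hA) 12 x y := by
  have hne {z : R} (hz : ev z ≠ 0) : z ≠ 0 := fun h ↦ hz (by rw [h, map_zero])
  have h1 := IsMultiple.one (hA := hA)
  have h2 : IsMultiple _ (.some 0 0 hA) 2
      (c * (c - 1) ^ 2 * (2 * c - 1) * (3 * c ^ 2 - 3 * c + 1) * (2 * c ^ 2 - 2 * c + 1))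
      (-c ^ 2 * (c - 1) ^ 2 * (2 * c - 1) ^ 2 * (3 * c ^ 2 - 3 * c + 1) ^ 2 *
        (2 * c ^ 2 - 2 * c + 1)) :=
    .two rfl (by simp only [kubertFamily, tateCurve]; ring)
      (by simp only [kubertFamily, tateCurve]; ring)
  have h3 : IsMultiple _ (.some 0 0 hA) 3 (-c * (c - 1) ^ 3 * (2 * c - 1) * (3 * c ^ 2 - 3 * c + 1))
      (c ^ 2 * (c - 1) ^ 5 * (2 * c - 1) ^ 2 * (3 * c ^ 2 - 3 * c + 1)) :=
    h2.succ (-c * (2 * c - 1) * (3 * c ^ 2 - 3 * c + 1)) (hne (by simp [hc, map_ofNat ev]))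
      (by ring)
      (by simp only [kubertFamily, tateCurve]; ring)
      (by simp only [kubertFamily, tateCurve]; ring)
  have h4 : IsMultiple _ (.some 0 0 hA) 4 (c * (c - 1) ^ 4 * (2 * c - 1) * (2 * c ^ 2 - 2 * c + 1))
      (-c ^ 2 * (c - 1) ^ 4 * (2 * c - 1) ^ 2 * (2 * c ^ 2 - 2 * c + 1) ^ 2) :=
    h3.succ (-c * (c - 1) ^ 2 * (2 * c - 1)) (hne (by simp [hc, map_ofNat ev]))
      (by ring)
      (by simp only [kubertFamily, tateCurve]; ring)
      (by simp only [kubertFamily, tateCurve]; ring)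
  have h5 : IsMultiple _ (.some 0 0 hA) 5
      (-c * (c - 1) * (2 * c - 1) * (3 * c ^ 2 - 3 * c + 1) * (2 * c ^ 2 - 2 * c + 1))
      (c ^ 2 * (c - 1) ^ 2 * (2 * c - 1) * (3 * c ^ 2 - 3 * c + 1) ^ 2 * (2 * c ^ 2 - 2 * c + 1)) :=
    h4.succ (-c * (2 * c - 1) * (2 * c ^ 2 - 2 * c + 1)) (hne (by simp [hc, map_ofNat ev]))
      (by ring)
      (by simp only [kubertFamily, tateCurve]; ring)
      (by simp only [kubertFamily, tateCurve]; ring)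
  have h6 : IsMultiple _ (.some 0 0 hA) 6 (c * (c - 1) ^ 5 * (3 * c ^ 2 - 3 * c + 1))
      (-c ^ 2 * (c - 1) ^ 6 * (3 * c ^ 2 - 3 * c + 1) ^ 2) :=
    h5.succ (-c * (c - 1) * (3 * c ^ 2 - 3 * c + 1)) (hne (by simp [hc, map_ofNat ev]))
      (by ring)
      (by simp only [kubertFamily, tateCurve]; ring)
      (by simp only [kubertFamily, tateCurve]; ring)
  refine exists_isIntegralCycle (by norm_num)
    (h6.add_eq_zero h6 (by simp only [kubertFamily, tateCurve]; ring)) ?_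
  intro i hi
  have hi₁ : 1 ≤ i := (mem_Icc.mp hi).1
  have hi₂ : i ≤ 6 := (mem_Icc.mp hi).2
  interval_cases i
  exacts [⟨_, _, h1⟩, ⟨_, _, h2⟩, ⟨_, _, h3⟩, ⟨_, _, h4⟩, ⟨_, _, h5⟩, ⟨_, _, h6⟩]

/-- All members of Kubert's family are elliptic curves. -/
lemma kubertFamily_Δ_ne_zero {l : ℕ} (hl : (3 ≤ l ∧ l ≤ 10) ∨ l = 12) (hc : ev c = 3)
    (ha : ev a = 3) : (kubertFamily l c a).Δ ≠ 0 := by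
  intro h
  have h' := congrArg ev h
  have hl' : 3 ≤ l ∧ l ≤ 12 := by omega
  obtain ⟨h3, h12⟩ := hl'
  interval_cases l <;> first | omega | skip
  all_goals
    simp [kubertFamily, tateCurve, WeierstrassCurve.Δ, WeierstrassCurve.b₂, WeierstrassCurve.b₄,
      WeierstrassCurve.b₆, WeierstrassCurve.b₈, hc, ha, map_ofNat ev] at h'

lemma exists_isIntegralCycle_kubertFamily {l : ℕ} (hl : (3 ≤ l ∧ l ≤ 10) ∨ l = 12)
    (hc : ev c = 3) (hA : ((kubertFamily l c a).baseChange F).toAffine.Nonsingular 0 0) :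
    ∃ x y, IsIntegralCycle (kubertFamily l c a) (Point.some 0 0 hA) l x y := by
  have hl' : l = 3 ∨ l = 4 ∨ l = 5 ∨ l = 6 ∨ l = 7 ∨ l = 8 ∨ l = 9 ∨ l = 10 ∨ l = 12 := by omega
  rcases hl' with rfl | rfl | rfl | rfl | rfl | rfl | rfl | rfl | rfl
  · exact exists_isIntegralCycle_three
  · exact exists_isIntegralCycle_four
  · exact exists_isIntegralCycle_five hc
  · exact exists_isIntegralCycle_six hc
  · exact exists_isIntegralCycle_seven hc
  · exact exists_isIntegralCycle_eight hc
  · exact exists_isIntegralCycle_nine hc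
  · exact exists_isIntegralCycle_ten hc
  · exact exists_isIntegralCycle_twelve hc

end Kubert

/-! ### The dihedral polynomials of Kubert's curves -/

open scoped Classical in
/-- The dihedral polynomials of Kubert's curves over a unique factorisation domain `R` of
characteristic zero containing the parameters. A homomorphism `ev` that maps the parameters to `3`
witnesses that finitely many polynomials in them do not vanish; `K` is the fraction field of `R[n]`
and `F` an algebraic closure of `K`. -/
theorem kubertFamily_dihedral {R K F : Type*} [CommRing R] [IsDomain R]
    [UniqueFactorizationMonoid R] [CharZero R] [Field K] [Field F] [Algebra R[X] K]
    [IsFractionRing R[X] K] [Algebra K F] [IsAlgClosure K F] {c a : R} {ev : R →+* ℤ}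
    (hc : ev c = 3) (ha : ev a = 3) {l : ℕ} (hl : (3 ≤ l ∧ l ≤ 10) ∨ l = 12) {φ : R[X] →+* F}
    (hφ : φ = (algebraMap K F).comp (algebraMap R[X] K)) {W : WeierstrassCurve.Affine F}
    (hW : W = ((kubertFamily l c a).map (φ.comp C)).toAffine) :
    W.IsElliptic ∧
    ∃ hA : W.Nonsingular 0 0,
      let A : W.Point := .some 0 0 hA
      addOrderOf A = l ∧
      ∃ p : R[X][X],
        (∃ P : W.Point, P ∉ AddSubgroup.zmultiples A ∧ translateSum A P l = φ X) ∧
        (∀ P : W.Point, P ∉ AddSubgroup.zmultiples A → translateSum A P l = φ X →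
          p.map φ = translatePoly A P l) ∧
        Irreducible (p.map (algebraMap R[X] K)) ∧
        Nonempty ((p.map (algebraMap R[X] K)).Gal ≃* DihedralGroup l) := by
  let : Algebra R[X] F := φ.toAlgebra
  let : Algebra R F := (φ.comp C).toAlgebra
  let : Algebra R K := ((algebraMap R[X] K).comp C).toAlgebra
  have : IsScalarTower R[X] K F := .of_algebraMap_eq' hφ
  have : IsScalarTower R R[X] F := .of_algebraMap_eq' rfl
  have : IsScalarTower R K F := .of_algebraMap_eq' (by
    change φ.comp C = (algebraMap K F).comp ((algebraMap R[X] K).comp C)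
    rw [hφ, RingHom.comp_assoc])
  have : FaithfulSMul R[X] F := by
    rw [faithfulSMul_iff_algebraMap_injective, IsScalarTower.algebraMap_eq R[X] K F]
    exact (algebraMap K F).injective.comp (IsFractionRing.injective R[X] K)
  have : FaithfulSMul R F := .trans R R[X] F
  have : IsAlgClosed F := IsAlgClosure.isAlgClosed K
  replace hW : W = ((kubertFamily l c a).baseChange F).toAffine := hW
  subst hW
  have hΔ : ((kubertFamily l c a).baseChange F).Δ ≠ 0 := by
    rw [WeierstrassCurve.baseChange, WeierstrassCurve.map_Δ, Ne,
      FaithfulSMul.algebraMap_eq_zero_iff]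
    exact kubertFamily_Δ_ne_zero hl hc ha
  have hA : ((kubertFamily l c a).baseChange F).toAffine.Nonsingular 0 0 := by
    refine (WeierstrassCurve.Affine.equation_iff_nonsingular_of_Δ_ne_zero hΔ).mp ?_
    have h6 : (kubertFamily l c a).a₆ = 0 := by
      unfold kubertFamily
      split <;> rfl
    rw [WeierstrassCurve.Affine.equation_zero, WeierstrassCurve.baseChange,
      WeierstrassCurve.map_a₆, h6, map_zero]
  obtain ⟨a', b', H⟩ := exists_isIntegralCycle_kubertFamily hl hc hA
  obtain ⟨P, hP, hn⟩ := H.exists_translateSum_eq hΔ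
  exact ⟨⟨hΔ.isUnit⟩, hA, H.addOrderOf_eq, fiberPoly (kubertFamily l c a) l a' b', ⟨P, hP, hn⟩,
    fun P hP hn ↦ H.map_fiberPoly_eq_translatePoly hP hn,
    (monic_fiberPoly _ l a' b').irreducible_iff_irreducible_map_fraction_map.mp
      H.irreducible_fiberPoly, H.nonempty_gal_mulEquiv (K := K) hP hn⟩

open scoped Classical in
theorem mainTheorem3 (l : ℕ) (hl : (3 ≤ l ∧ l ≤ 10) ∨ l = 12) :
    (geomCurve l).IsElliptic ∧
    ∃ hA : (geomCurve l).Nonsingular 0 0,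
      let A : (geomCurve l).Point := .some 0 0 hA
      addOrderOf A = l ∧
      ∃ p : (ParamRing l)[X],
        (∃ P : (geomCurve l).Point,
          P ∉ AddSubgroup.zmultiples A ∧ translateSum A P l = nParam l) ∧
        (∀ P : (geomCurve l).Point,
          P ∉ AddSubgroup.zmultiples A → translateSum A P l = nParam l →
          p.map (toClosure l) = translatePoly A P l) ∧
        Irreducible (p.map (toField l)) ∧
        Nonempty ((p.map (toField l)).Gal ≃* DihedralGroup l) :=
  -- All parameters are evaluated at `3`.
  kubertFamily_dihedral (ev := MvPolynomial.eval fun _ ↦ 3) (MvPolynomial.eval_X _)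
    (MvPolynomial.eval_X _) hl rfl rfl
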